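/- **The multiplicity formula.** Let $\mathbb K$ be an algebraically closed field of characteristic zero, let $\mathcal Z\subset\mathbb K^3$ be a rational affine surface, that is, the zero set of an irreducible polynomial $f(x,y,z)$, which is not a plane parallel to a coordinate plane, and let $$\mathcal Q(t,s)=\left(\frac{N_1}{D_1},\frac{N_2}{D_2},\frac{N_3}{D_3}\right),\qquad N_i,D_i\in\mathbb K[t,s],\quad \gcd(N_i,D_i)=1,\quad D_i\ne 0,$$ be a rational parametrization of $\mathcal Z$ (its image is contained in $\mathcal Z$ and Zariski dense in it; $\mathcal Q$ need not be birational). For $A=(a,b,c)\in\mathbb K^3$ let $$\Phi_{2,3}(A)=(\chi^A_1,\chi^A_2)=\left(\frac{N_2-bD_2}{N_1-aD_1}\cdot\frac{D_1}{D_2},\ \frac{N_3-cD_3}{N_1-aD_1}\cdot\frac{D_1}{D_3}\right):\mathbb K^2\dashrightarrow\mathbb K^2 .$$ Let $g_i^{\mathcal Q,A}\in\mathbb K[h_1,h_2][t,s]$ be the numerator, in reduced form, of $\chi^A_i(t,s)-\chi^A_i(h_1,h_2)$ for $i=1,2$, let $G$ be a greatest common divisor of $g_1^{\mathcal Q,A}$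 and $g_2^{\mathcal Q,A}$ in $\mathbb K[h_1,h_2][t,s]$, and put $g^{\mathcal Q,A}=G$ if $\deg_{\{t,s\}}G>0$ and $g^{\mathcal Q,A}=1$ otherwise. Let $\operatorname{mult}(A,\mathcal Z)$ be the multiplicity of $A$ on $\mathcal Z$, i.e. the least degree of a nonzero homogeneous component of $f(x+a,y+b,z+c)$ (so it is $0$ if $A\notin\mathcal Z$). For a rational map $\theta$ on $\mathbb K^2$, let $\deg(\theta)=[\mathbb K(t,s):\mathbb K(\theta)]$ be its degree (onto the closure of its image). Let $A_0=(a_0,b_0,c_0)\in\mathbb K^3\setminus\mathcal Z$ and $A=(a,b,c)\in\mathbb K^3$. Assume that none of the projective curves defined by the non-constant polynomials among $N_i$, $D_i$ ($i=1,2,3$), $N_1-aD_1$, $N_2-bD_2$, $N_3-cD_3$, $N_1-a_0D_1$, $N_2-b_0D_2$, $N_3-c_0D_3$ passes through $(0:1:0)$ (coordinates ordered so that $t,s$ are the first two and the line at infinity is the vanishing of the third). Then $\deg(\mathcal Q)$ and $\deg(\Phi_{2,3}(A_0))$ are finite, and: 1. if $g^{\mathcal Q,A}=1$, then $\deg(\Phi_{2,3}(A))$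 is finite and $$\operatorname{mult}(A,\mathcal Z)=\frac{\deg(\Phi_{2,3}(A_0))-\deg(\Phi_{2,3}(A))}{\deg(\mathcal Q)};$$ 2. if $g^{\mathcal Q,A}\neq1$, then $$\operatorname{mult}(A,\mathcal Z)=\frac{\deg(\Phi_{2,3}(A_0))}{\deg(\mathcal Q)}.$$ -/

import Mathlib

open MvPolynomial

namespace RationalSurface

noncomputable section

/-- The field `K(t,s)` of rational functions in two variables; `t = X 0` and `s = X 1`. -/
abbrev RatFun (K : Type*) [Field K] : Type _ :=
  FractionRing (MvPolynomial (Fin 2) K)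

/-- The ring `K[h₁,h₂][t,s]`: polynomials in `t, s` with coefficients in `K[h₁,h₂]`. -/
abbrev PolyTSH (K : Type*) [Field K] : Type _ :=
  MvPolynomial (Fin 2) (MvPolynomial (Fin 2) K)

/-- The field `K(t,s,h₁,h₂)`. -/
abbrev RatFunTSH (K : Type*) [Field K] : Type _ :=
  FractionRing (PolyTSH K)

/-- A polynomial in `K[t,s]`, seen as a rational function. -/
def toRat {K : Type*} [Field K] (p : MvPolynomial (Fin 2) K) : RatFun K :=
  algebraMap (MvPolynomial (Fin 2) K) (RatFun K) p

/-- `f` is a defining polynomial of the irreducible affine surface `Z ⊆ K³`. -/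
def IsDefiningPolynomial {K : Type*} [Field K] (f : MvPolynomial (Fin 3) K)
    (Z : Set (Fin 3 → K)) : Prop :=
  Irreducible f ∧ Z = {P | eval P f = 0}

/-- The set of points `(N₁/D₁, N₂/D₂, N₃/D₃)(p)` for the parameter values `p ∈ K²` at which no
denominator vanishes. -/
def paramImage {K : Type*} [Field K] (N D : Fin 3 → MvPolynomial (Fin 2) K) :
    Set (Fin 3 → K) :=
  {P | ∃ p : Fin 2 → K, (∀ i, eval p (D i) ≠ 0) ∧ ∀ i, P i = eval p (N i) / eval p (D i)}

/-- `(N₁/D₁, N₂/D₂, N₃/D₃)` is a rational parametrization, in reduced form, of `Z`: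
the fractions are reduced and `Z` is the Zariski closure of the image. -/
structure IsRationalParametrization {K : Type*} [Field K]
    (N D : Fin 3 → MvPolynomial (Fin 2) K) (Z : Set (Fin 3 → K)) : Prop where
  den_ne_zero : ∀ i, D i ≠ 0
  reduced : ∀ i, IsRelPrime (N i) (D i)
  closure_image : zeroLocus K (vanishingIdeal K (paramImage N D)) = Z

/-- The polynomial `f(x + a, y + b, z + c)`, for `A = (a,b,c)`. -/
def translate {K : Type*} [Field K] (f : MvPolynomial (Fin 3) K) (A : Fin 3 → K) :
    MvPolynomial (Fin 3) K :=
  aeval (fun i => X i + C (A i)) f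

/-- The multiplicity of the point `A` on the surface with defining polynomial `f`: the order at
the origin of `f(x + a, y + b, z + c)`, that is, the least degree of a nonzero homogeneous
component of it. It is `0` exactly when `A` is not on the surface. -/
def mult {K : Type*} [Field K] (A : Fin 3 → K) (f : MvPolynomial (Fin 3) K) : ℕ :=
  sInf {n | homogeneousComponent n (translate f A) ≠ 0}

/-- The degree of the rational map given by a tuple `θ` of rational functions in `t, s`:
the degree of the field extension `K(t,s) / K(θ)`, where `K(θ)` is the function field of the
closure of the image (and `0` when this extension is infinite). -/
def mapDegree {K : Type*} [Field K] {m : ℕ} (θ : Fin m → RatFun K) : ℕ :=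
  Module.finrank (IntermediateField.adjoin K (Set.range θ)) (RatFun K)

/-- The rational map `K² ⇢ K³` given by `(N₁/D₁, N₂/D₂, N₃/D₃)`. -/
def paramMap {K : Type*} [Field K] (N D : Fin 3 → MvPolynomial (Fin 2) K) :
    Fin 3 → RatFun K :=
  fun i => toRat (N i) / toRat (D i)

/-- The rational map `Φ_{2,3}(A) : K² ⇢ K²`, for `A = (a,b,c)`. -/
def Phi23 {K : Type*} [Field K] (N D : Fin 3 → MvPolynomial (Fin 2) K) (A : Fin 3 → K) :
    Fin 2 → RatFun K :=
  ![toRat (N 1 - C (A 1) * D 1) / toRat (N 0 - C (A 0) * D 0) * (toRat (D 0) / toRat (D 1)),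
    toRat (N 2 - C (A 2) * D 2) / toRat (N 0 - C (A 0) * D 0) * (toRat (D 0) / toRat (D 2))]

/-- The inclusion `K(t,s) → K(t,s,h₁,h₂)`, `χ ↦ χ(t,s)`. -/
def inTS (K : Type*) [Field K] : RatFun K →+* RatFunTSH K :=
  IsFractionRing.map
    (j := (MvPolynomial.map C : MvPolynomial (Fin 2) K →+* PolyTSH K))
    (map_injective _ (C_injective (Fin 2) K))

/-- The embedding `K(t,s) → K(t,s,h₁,h₂)`, `χ ↦ χ(h₁,h₂)`. -/
def inH (K : Type*) [Field K] : RatFun K →+* RatFunTSH K :=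
  IsFractionRing.map
    (j := (C : MvPolynomial (Fin 2) K →+* PolyTSH K))
    (C_injective (Fin 2) (MvPolynomial (Fin 2) K))

/-- The polynomial `numer(χ_i(t,s) - χ_i(h₁,h₂))`, where `χ_i` is the `i`-th component
of `Φ_{2,3}(A)` and `numer` is the numerator in reduced form. -/
def gComp {K : Type*} [Field K] (N D : Fin 3 → MvPolynomial (Fin 2) K) (A : Fin 3 → K)
    (i : Fin 2) : PolyTSH K :=
  IsFractionRing.num (PolyTSH K) (inTS K (Phi23 N D A i) - inH K (Phi23 N D A i))

/-- The greatest common divisor of the two polynomials `gComp` in `K[h₁,h₂][t,s]`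
(well defined up to a unit). -/
def gGcd {K : Type*} [Field K] (N D : Fin 3 → MvPolynomial (Fin 2) K) (A : Fin 3 → K) :
    PolyTSH K :=
  letI := UniqueFactorizationMonoid.toGCDMonoid (PolyTSH K)
  gcd (gComp N D A 0) (gComp N D A 1)

open Classical in
/-- The polynomial `g^{Q,A}`: the gcd if it has positive degree in `{t,s}`, and `1` otherwise. -/
def gPoly {K : Type*} [Field K] (N D : Fin 3 → MvPolynomial (Fin 2) K) (A : Fin 3 → K) :
    PolyTSH K :=
  if 0 < (gGcd N D A).totalDegree then gGcd N D A else 1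

/-- The projective plane curve defined by a polynomial `p` passes through `(0:1:0)`: the
homogenization of `p` vanishes there. At a point `(t:s:0)` the homogenization takes the value of
the leading form of `p` at `(t,s)`. -/
def PassesThroughInfty {K : Type*} [Field K] (p : MvPolynomial (Fin 2) K) : Prop :=
  eval ![0, 1] (homogeneousComponent p.totalDegree p) = 0

/-- If `p` is non-constant then its projective curve does not pass through `(0:1:0)`. -/
def AvoidsInfty {K : Type*} [Field K] (p : MvPolynomial (Fin 2) K) : Prop :=
  0 < p.totalDegree → ¬ PassesThroughInfty p

end

end RationalSurface

/-! Let `F = K(t,s)` and let `x` be the generic point of the surface, with coordinates `paramMap N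
D`. By the Nullstellensatz the polynomial relations between the coordinates of `x` form the ideal
`(f)`. The components of `Phi23 N D P` are the slopes of the line from `P` to `x`, so with `a = x 0
- P 0` the field `K(x)` is `K(slopes)(a)`.

The degree of this extension is found in a chart of the blow-up at `P`. Substituting `(T, UT, VT)`
into the translate of `f` gives a polynomial in `T` of degree `d = deg f` and order `mult P f`;
divided by that power of `T`, it annihilates `a` at the slopes. Nothing of smaller degree does: any
relation, multiplied by a power of `T`, comes from `K[x,y,z]`, where it is divisible by the
translate of `f`, and degree minus order is additive (`natDegree_blowUp_sub_le`). If the slopes are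
algebraically independent, the tower law thus gives `deg Φ(P) = (d - mult P) · deg Q`
(`finrank_adjoin_slopes`). A relation between the slopes is a relation of degree 0 in `T`, which
forces `mult P = d` (`mult_eq_totalDegree`); off the surface the multiplicity is 0 < `d`, so the
slopes at `A₀` are independent and `deg Φ(A₀) = d · deg Q`.

It remains to see that `gPoly` is 1 exactly when the slopes at `A` are independent. A common prime
factor of positive degree would make `t` and `s` both algebraic over `K(h₁,h₂)` in its residue
field, which independence of the slopes forbids (`totalDegree_eq_zero_of_dvd_numerDiff`). For
dependent slopes, a prime factor of one numerator through the diagonal divides the other, by a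
divided difference of a separable relation (`dvd_numerDiff_of_not_algebraicIndependent`). -/

namespace RationalSurface

universe u v w x

/-! ### The ideal of relations of a parametrization. -/

/-- Clearing denominators uniformly: a polynomial expression in the fractions `n i / d i` is a
fraction `r / s` in every field to which the ring maps with nonzero images of all `d i`. -/
theorem exists_fraction_eq_aeval {K : Type u} {R : Type v} {ι : Type w} [Field K] [CommRing R]
    [Algebra K R] (n d : ι → R) (g : MvPolynomial ι K) :
    ∃ r s : R, ∀ (E : Type x) [Field E] [Algebra K E] (α : R →ₐ[K] E), (∀ i, α (d i) ≠ 0) →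
      α s ≠ 0 ∧ aeval (fun i => α (n i) / α (d i)) g = α r / α s := by
  induction g using MvPolynomial.induction_on with
  | C c =>
    refine ⟨algebraMap K R c, 1, fun E _ _ α _ => ⟨by simp, ?_⟩⟩
    simp
  | add p q hp hq =>
    obtain ⟨r₁, s₁, h₁⟩ := hp
    obtain ⟨r₂, s₂, h₂⟩ := hq
    refine ⟨r₁ * s₂ + s₁ * r₂, s₁ * s₂, fun E _ _ α hα => ?_⟩
    obtain ⟨a₁, b₁⟩ := h₁ E α hα
    obtain ⟨a₂, b₂⟩ := h₂ E α hα
    refine ⟨by simp [a₁, a₂], ?_⟩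
    rw [map_add, b₁, b₂, div_add_div _ _ a₁ a₂]
    simp
  | mul_X p i hp =>
    obtain ⟨r, s, h⟩ := hp
    refine ⟨r * n i, s * d i, fun E _ _ α hα => ?_⟩
    obtain ⟨a, b⟩ := h E α hα
    refine ⟨by simp [a, hα i], ?_⟩
    rw [map_mul, b, aeval_X, div_mul_div_comm]
    simp

theorem toRat_ne_zero {K : Type u} [Field K] {p : MvPolynomial (Fin 2) K} (hp : p ≠ 0) :
    toRat p ≠ 0 :=
  (map_ne_zero_iff _ (IsFractionRing.injective _ _)).2 hp

theorem exists_eval_ne_zero {K : Type u} [Field K] [Infinite K] {σ : Type v}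
    {p : MvPolynomial σ K} (hp : p ≠ 0) : ∃ a : σ → K, eval a p ≠ 0 := by
  by_contra! h
  exact hp (MvPolynomial.funext fun a => by simpa using h a)

/-- The polynomial relations between the components of a parametrization are exactly the
polynomials vanishing on its image. -/
theorem aeval_paramMap_eq_zero_iff {K : Type u} [Field K] [Infinite K]
    {N D : Fin 3 → MvPolynomial (Fin 2) K} (hD : ∀ i, D i ≠ 0) (g : MvPolynomial (Fin 3) K) :
    aeval (paramMap N D) g = 0 ↔ g ∈ vanishingIdeal K (paramImage N D) := by
  obtain ⟨r, s, h⟩ := exists_fraction_eq_aeval.{u, u, 0, u} N D g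
  obtain ⟨hs, hr⟩ := h (RatFun K)
    ((Algebra.ofId (MvPolynomial (Fin 2) K) (RatFun K)).restrictScalars K)
    (fun i => toRat_ne_zero (hD i))
  replace hr : aeval (paramMap N D) g = toRat r / toRat s := hr
  replace hs : toRat s ≠ 0 := hs
  have hev : ∀ p : Fin 2 → K, (∀ i, eval p (D i) ≠ 0) →
      eval p s ≠ 0 ∧ eval (fun i => eval p (N i) / eval p (D i)) g = eval p r / eval p s := by
    intro p hp
    have := h K (aeval p) (by simpa [aeval_eq_eval] using hp)
    simpa [aeval_eq_eval] using this
  rw [mem_vanishingIdeal_iff]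
  constructor
  · intro h0
    have r0 : r = 0 := by
      by_contra hne
      rw [hr] at h0
      exact div_ne_zero (toRat_ne_zero hne) hs h0
    rintro P ⟨p, hp, hP⟩
    obtain rfl : P = _ := _root_.funext hP
    rw [aeval_eq_eval]
    simpa [r0] using (hev p hp).2
  · intro h0
    have r0 : r = 0 := by
      by_contra hne
      -- One parameter value at which neither the numerator `r` nor any denominator vanishes.
      obtain ⟨p, hp⟩ := exists_eval_ne_zero
        (mul_ne_zero hne (Finset.prod_ne_zero_iff.2 fun i (_ : i ∈ Finset.univ) => hD i))
      rw [map_mul, map_prod, mul_ne_zero_iff, Finset.prod_ne_zero_iff] at hp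
      have hDp : ∀ i, eval p (D i) ≠ 0 := fun i => hp.2 i (Finset.mem_univ i)
      have h1 := h0 _ ⟨p, hDp, fun i => rfl⟩
      rw [aeval_eq_eval] at h1
      have h2 := hev p hDp
      rw [show eval _ g = 0 from h1] at h2
      exact div_ne_zero hp.1 h2.1 h2.2.symm
    rw [hr, r0]
    simp [toRat]

/-- Nullstellensatz for the ideal `(f)`, which is prime and hence radical. -/
theorem dvd_of_forall_zeroLocus {K : Type u} [Field K] [IsAlgClosed K] {σ : Type v} [Finite σ]
    {f g : MvPolynomial σ K} (hf : Irreducible f) (h : ∀ P, eval P f = 0 → eval P g = 0) :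
    f ∣ g := by
  have : (Ideal.span {f}).IsPrime := (Ideal.span_singleton_prime hf.ne_zero).2 hf.prime
  rw [← Ideal.mem_span_singleton, ← IsPrime.vanishingIdeal_zeroLocus (K := K) (Ideal.span {f}),
    mem_vanishingIdeal_iff]
  intro P hP
  rw [zeroLocus_span] at hP
  have := h P (by simpa [aeval_eq_eval] using hP)
  simpa [aeval_eq_eval] using this

/-- The defining polynomial generates the relations between the components of a
parametrization. -/
theorem aeval_paramMap_eq_zero_iff_dvd {K : Type u} [Field K] [IsAlgClosed K]
    {Z : Set (Fin 3 → K)} {f : MvPolynomial (Fin 3) K} (hf : IsDefiningPolynomial f Z)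
    {N D : Fin 3 → MvPolynomial (Fin 2) K} (hQ : IsRationalParametrization N D Z)
    (g : MvPolynomial (Fin 3) K) : aeval (paramMap N D) g = 0 ↔ f ∣ g := by
  have : Infinite K := IsAlgClosed.instInfinite
  rw [aeval_paramMap_eq_zero_iff hQ.den_ne_zero]
  constructor
  · intro hg
    refine dvd_of_forall_zeroLocus hf.1 fun P hP => ?_
    have hPZ : P ∈ Z := by rw [hf.2]; exact hP
    rw [← hQ.closure_image, mem_zeroLocus_iff] at hPZ
    simpa [aeval_eq_eval] using hPZ g hg
  · intro hg
    rw [mem_vanishingIdeal_iff]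
    intro P hP
    have hPZ : P ∈ Z := hQ.closure_image ▸ zeroLocus_vanishingIdeal_le _ hP
    rw [hf.2] at hPZ
    obtain ⟨q, rfl⟩ := hg
    have : eval P f = 0 := hPZ
    simp [aeval_eq_eval, this]

/-! ### A chart of the blow-up of the origin: degree and order. -/

noncomputable section

/-- The substitution `(x, y, z) = (T, U T, V T)`, a chart of the blowing up of the origin. -/
def blowUp (K : Type u) [Field K] :
    MvPolynomial (Fin 3) K →ₐ[K] Polynomial (MvPolynomial (Fin 2) K) :=
  aeval ![Polynomial.X, Polynomial.C (X 0) * Polynomial.X, Polynomial.C (X 1) * Polynomial.X]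

variable {K : Type u} [Field K]

theorem eval₂_blowUp {A : Type v} [CommRing A] [Algebra K A] (θ : Fin 2 → A) (a : A)
    (p : MvPolynomial (Fin 3) K) :
    (blowUp K p).eval₂ (aeval θ : MvPolynomial (Fin 2) K →ₐ[K] A).toRingHom a =
      aeval ![a, θ 0 * a, θ 1 * a] p := by
  induction p using MvPolynomial.induction_on with
  | C c =>
    rw [blowUp, aeval_C, aeval_C, Polynomial.algebraMap_apply, Polynomial.eval₂_C]
    simp
  | add p q hp hq => rw [map_add, map_add, Polynomial.eval₂_add, hp, hq]
  | mul_X p i hp =>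
    rw [map_mul, map_mul, Polynomial.eval₂_mul, hp]
    fin_cases i <;> simp [blowUp]

/-- The chart is birational: `T = x`, `U = y/x`, `V = z/x` recovers the polynomial in the fraction
field. -/
theorem blowUp_injective : Function.Injective (blowUp K) := by
  let F := FractionRing (MvPolynomial (Fin 3) K)
  let ξ : Fin 3 → F := fun i => algebraMap _ F (X i : MvPolynomial (Fin 3) K)
  have hξ : ξ 0 ≠ 0 := (map_ne_zero_iff _ (IsFractionRing.injective _ _)).2 (X_ne_zero 0)
  have key : ∀ p, (blowUp K p).eval₂
      (aeval ![ξ 1 / ξ 0, ξ 2 / ξ 0] : MvPolynomial (Fin 2) K →ₐ[K] F).toRingHom (ξ 0) =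
        algebraMap _ F p := by
    intro p
    rw [eval₂_blowUp]
    have h1 : ![ξ 0, ![ξ 1 / ξ 0, ξ 2 / ξ 0] 0 * ξ 0, ![ξ 1 / ξ 0, ξ 2 / ξ 0] 1 * ξ 0] = ξ := by
      ext i
      fin_cases i
      · rfl
      · exact div_mul_cancel₀ _ hξ
      · exact div_mul_cancel₀ _ hξ
    rw [h1]
    have := aeval_algebraMap_apply F (X : Fin 3 → MvPolynomial (Fin 3) K) p
    rw [aeval_X_left_apply] at this
    exact this
  intro p q hpq
  apply IsFractionRing.injective (MvPolynomial (Fin 3) K) F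
  rw [← key, ← key, hpq]

/-- A monomial of degree `n` becomes `T ^ n` times its dehomogenization, so the grading by degree
turns into the grading by powers of `T`. -/
theorem coeff_blowUp (p : MvPolynomial (Fin 3) K) (n : ℕ) :
    (blowUp K p).coeff n =
      aeval ![1, X 0, X 1] (homogeneousComponent n p) := by
  induction p using MvPolynomial.induction_on' with
  | add p q hp hq => simp [hp, hq]
  | monomial s c =>
    have h1 : blowUp K (monomial s c) =
        Polynomial.C (aeval ![1, X 0, X 1] (monomial s c)) * Polynomial.X ^ s.degree := by
      rw [aeval_monomial, blowUp, aeval_monomial, Finsupp.prod_fintype _ _ (by simp),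
        Finsupp.prod_fintype _ _ (by simp), Finsupp.degree_eq_sum]
      simp only [Fin.prod_univ_three, Fin.sum_univ_three]
      simp [mul_pow, Polynomial.algebraMap_apply]
      ring
    rw [h1, Polynomial.coeff_C_mul_X_pow]
    have h2 : monomial s c ∈ homogeneousSubmodule (Fin 3) K s.degree := isHomogeneous_monomial c rfl
    rw [homogeneousComponent_of_mem h2]
    split_ifs with h <;> simp_all

/-- Dehomogenizing a single homogeneous component loses nothing: its image under `blowUp` is just
its own `T ^ n` term, and `blowUp` is injective. -/
theorem coeff_blowUp_ne_zero_iff (p : MvPolynomial (Fin 3) K) (n : ℕ) :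
    (blowUp K p).coeff n ≠ 0 ↔ homogeneousComponent n p ≠ 0 := by
  rw [not_iff_not]
  refine ⟨fun h => ?_, fun h => by rw [coeff_blowUp, h, map_zero]⟩
  refine blowUp_injective (Polynomial.ext fun k => ?_)
  rw [map_zero, Polynomial.coeff_zero, coeff_blowUp,
    homogeneousComponent_of_mem (homogeneousComponent_mem n p)]
  split_ifs with hk
  · rw [← coeff_blowUp, h]
  · rw [map_zero]

theorem natDegree_blowUp (p : MvPolynomial (Fin 3) K) :
    (blowUp K p).natDegree = p.totalDegree := by
  rcases eq_or_ne p 0 with rfl | hp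
  · simp
  apply le_antisymm
  · rw [Polynomial.natDegree_le_iff_coeff_eq_zero]
    intro n hn
    rw [coeff_blowUp, homogeneousComponent_eq_zero n p hn, map_zero]
  · apply Polynomial.le_natDegree_of_ne_zero
    rw [coeff_blowUp_ne_zero_iff]
    obtain ⟨s, hs, hsd⟩ := Finset.exists_mem_eq_sup p.support (support_nonempty.2 hp)
      (fun s : Fin 3 →₀ ℕ => s.sum fun _ e => e)
    intro h0
    have h1 := congrArg (coeff s) h0
    rw [coeff_homogeneousComponent, if_pos] at h1
    · exact (mem_support_iff.1 hs) h1
    · rw [totalDegree, hsd]; rfl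

theorem natTrailingDegree_blowUp {p : MvPolynomial (Fin 3) K} (hp : p ≠ 0) :
    (blowUp K p).natTrailingDegree = sInf {n | homogeneousComponent n p ≠ 0} := by
  have h0 : blowUp K p ≠ 0 := (map_ne_zero_iff _ blowUp_injective).2 hp
  have h1 : {n | homogeneousComponent n p ≠ 0} = {n | (blowUp K p).coeff n ≠ 0} :=
    Set.ext fun n => (coeff_blowUp_ne_zero_iff p n).symm
  rw [h1]
  apply le_antisymm
  · exact Polynomial.natTrailingDegree_le_of_ne_zero
      (Nat.sInf_mem (s := {n | (blowUp K p).coeff n ≠ 0})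
        ⟨_, Polynomial.coeff_natTrailingDegree_ne_zero.2 h0⟩)
  · exact Nat.sInf_le (Polynomial.coeff_natTrailingDegree_ne_zero.2 h0)

/-- The image of `blowUp` contains `T`, `UT` and `VT`, so it becomes everything once `T` is
inverted. This lets relations over `K[U,V]` be pulled back to `K[x,y,z]`. -/
theorem exists_blowUp_eq_X_pow_mul (q : Polynomial (MvPolynomial (Fin 2) K)) :
    ∃ (k : ℕ) (p : MvPolynomial (Fin 3) K), blowUp K p = Polynomial.X ^ k * q := by
  have hadd : ∀ q₁ q₂ : Polynomial (MvPolynomial (Fin 2) K),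
      (∃ (k : ℕ) (p : MvPolynomial (Fin 3) K), blowUp K p = Polynomial.X ^ k * q₁) →
      (∃ (k : ℕ) (p : MvPolynomial (Fin 3) K), blowUp K p = Polynomial.X ^ k * q₂) →
      ∃ (k : ℕ) (p : MvPolynomial (Fin 3) K), blowUp K p = Polynomial.X ^ k * (q₁ + q₂) := by
    rintro q₁ q₂ ⟨k₁, p₁, h₁⟩ ⟨k₂, p₂, h₂⟩
    -- `X 0` maps to `T`, so the crossed powers bring both summands to the common exponent `k₁ +
    -- k₂`.
    refine ⟨k₁ + k₂, X 0 ^ k₂ * p₁ + X 0 ^ k₁ * p₂, ?_⟩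
    rw [map_add, map_mul, map_mul, h₁, h₂]
    simp [blowUp]
    ring
  have hmul : ∀ q₁ q₂ : Polynomial (MvPolynomial (Fin 2) K),
      (∃ (k : ℕ) (p : MvPolynomial (Fin 3) K), blowUp K p = Polynomial.X ^ k * q₁) →
      (∃ (k : ℕ) (p : MvPolynomial (Fin 3) K), blowUp K p = Polynomial.X ^ k * q₂) →
      ∃ (k : ℕ) (p : MvPolynomial (Fin 3) K), blowUp K p = Polynomial.X ^ k * (q₁ * q₂) := by
    rintro q₁ q₂ ⟨k₁, p₁, h₁⟩ ⟨k₂, p₂, h₂⟩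
    exact ⟨k₁ + k₂, p₁ * p₂, by rw [map_mul, h₁, h₂]; ring⟩
  have hC : ∀ r : MvPolynomial (Fin 2) K,
      ∃ (k : ℕ) (p : MvPolynomial (Fin 3) K), blowUp K p = Polynomial.X ^ k * Polynomial.C r := by
    intro r
    induction r using MvPolynomial.induction_on with
    | C c => exact ⟨0, C c, by simp [blowUp, Polynomial.algebraMap_apply]⟩
    | add p q hp hq => rw [Polynomial.C_add]; exact hadd _ _ hp hq
    | mul_X p i hp =>
      rw [Polynomial.C_mul]
      refine hmul _ _ hp ⟨1, X i.succ, ?_⟩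
      fin_cases i <;> simp [blowUp]
  induction q using Polynomial.induction_on' with
  | add q₁ q₂ h₁ h₂ => exact hadd _ _ h₁ h₂
  | monomial n r =>
    rw [← Polynomial.C_mul_X_pow_eq_monomial]
    exact hmul _ _ (hC r) ⟨0, X 0 ^ n, by simp [blowUp]⟩

/-- If `p` divides every polynomial vanishing at `(a, θ₀ a, θ₁ a)`, then every relation for `a`
over `K[θ₀, θ₁]` has degree at least the difference of the degree and the order of `p`. -/
theorem natDegree_blowUp_sub_le {A : Type v} [CommRing A] [Algebra K A] (θ : Fin 2 → A) (a : A)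
    {p : MvPolynomial (Fin 3) K}
    (hp : ∀ g, aeval ![a, θ 0 * a, θ 1 * a] g = 0 → p ∣ g)
    {q : Polynomial (MvPolynomial (Fin 2) K)} (hq : q ≠ 0)
    (hqa : q.eval₂ (aeval θ : MvPolynomial (Fin 2) K →ₐ[K] A).toRingHom a = 0) :
    (blowUp K p).natDegree - (blowUp K p).natTrailingDegree ≤ q.natDegree := by
  obtain ⟨k, g, hg⟩ := exists_blowUp_eq_X_pow_mul q
  have h0 : aeval ![a, θ 0 * a, θ 1 * a] g = 0 := by
    rw [← eval₂_blowUp, hg, Polynomial.eval₂_mul, hqa, mul_zero]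
  obtain ⟨c, hc⟩ := hp g h0
  rw [hc, map_mul] at hg
  generalize blowUp K p = p' at hg ⊢
  generalize blowUp K c = c' at hg
  have hX : (Polynomial.X ^ k : Polynomial (MvPolynomial (Fin 2) K)) ≠ 0 :=
    pow_ne_zero _ Polynomial.X_ne_zero
  have hpc : p' ≠ 0 ∧ c' ≠ 0 := by
    rw [← mul_ne_zero_iff, hg]
    exact mul_ne_zero hX hq
  have hdeg := congrArg Polynomial.natDegree hg
  have htr := congrArg Polynomial.natTrailingDegree hg
  rw [Polynomial.natDegree_mul hpc.1 hpc.2, Polynomial.natDegree_mul hX hq,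
    Polynomial.natDegree_X_pow] at hdeg
  rw [Polynomial.natTrailingDegree_mul hpc.1 hpc.2, Polynomial.natTrailingDegree_mul hX hq,
    Polynomial.natTrailingDegree_X_pow] at htr
  have := Polynomial.natTrailingDegree_le_natDegree c'
  -- Degree minus order is additive and vanishes for `T ^ k`, so that of `p'` is at most that of
  -- `q`, hence at most the degree of `q`.
  omega

end

/-! ### Multiplicity and the degree of the projection from a point. -/

noncomputable section

section Translation

variable {K : Type u} [Field K]

theorem aeval_translate {A : Type v} [CommRing A] [Algebra K A] (x : Fin 3 → A)
    (f : MvPolynomial (Fin 3) K) (P : Fin 3 → K) :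
    aeval x (translate f P) = aeval (fun i => x i + algebraMap K A (P i)) f := by
  have : (aeval x).comp (aeval fun i => X i + C (P i) : MvPolynomial (Fin 3) K →ₐ[K] _) =
      aeval (fun i => x i + algebraMap K A (P i)) := by
    ext i
    simp
  exact DFunLike.congr_fun this f

theorem translate_translate_neg (f : MvPolynomial (Fin 3) K) (P : Fin 3 → K) :
    translate (translate f P) (-P) = f := by
  rw [translate, aeval_translate]
  simp [MvPolynomial.algebraMap_eq]

theorem translate_neg_translate (f : MvPolynomial (Fin 3) K) (P : Fin 3 → K) :
    translate (translate f (-P)) P = f := by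
  simpa using translate_translate_neg f (-P)

theorem translate_ne_zero {f : MvPolynomial (Fin 3) K} (hf : f ≠ 0) (P : Fin 3 → K) :
    translate f P ≠ 0 := by
  intro h
  apply hf
  rw [← translate_translate_neg f P, h]
  simp [translate]

theorem totalDegree_translate_le (f : MvPolynomial (Fin 3) K) (P : Fin 3 → K) :
    (translate f P).totalDegree ≤ f.totalDegree := by
  rw [translate, aeval_def, eval₂_eq']
  refine totalDegree_finsetSum_le fun s hs => ?_
  refine (totalDegree_mul _ _).trans ?_
  rw [MvPolynomial.algebraMap_eq, totalDegree_C, zero_add]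
  refine (totalDegree_finsetProd _ _).trans ?_
  refine le_trans ?_ (le_totalDegree hs)
  rw [Finsupp.sum_fintype _ _ (by simp)]
  refine Finset.sum_le_sum fun i _ => (totalDegree_pow _ _).trans ?_
  have : (X i + C (P i) : MvPolynomial (Fin 3) K).totalDegree ≤ 1 :=
    (totalDegree_add _ _).trans (by simp)
  nlinarith

theorem totalDegree_translate (f : MvPolynomial (Fin 3) K) (P : Fin 3 → K) :
    (translate f P).totalDegree = f.totalDegree := by
  refine le_antisymm (totalDegree_translate_le f P) ?_
  conv_lhs => rw [← translate_translate_neg f P]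
  exact totalDegree_translate_le _ _

theorem natDegree_blowUp_translate (f : MvPolynomial (Fin 3) K) (P : Fin 3 → K) :
    (blowUp K (translate f P)).natDegree = f.totalDegree := by
  rw [natDegree_blowUp, totalDegree_translate]

theorem natTrailingDegree_blowUp_translate {f : MvPolynomial (Fin 3) K} (hf : f ≠ 0)
    (P : Fin 3 → K) : (blowUp K (translate f P)).natTrailingDegree = mult P f :=
  natTrailingDegree_blowUp (translate_ne_zero hf P)

theorem mult_le_totalDegree {f : MvPolynomial (Fin 3) K} (hf : f ≠ 0) (P : Fin 3 → K) :
    mult P f ≤ f.totalDegree := by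
  rw [← natTrailingDegree_blowUp_translate hf, ← natDegree_blowUp_translate f P]
  exact Polynomial.natTrailingDegree_le_natDegree _

theorem mult_eq_zero {f : MvPolynomial (Fin 3) K} {P : Fin 3 → K} (hP : eval P f ≠ 0) :
    mult P f = 0 := by
  refine Nat.sInf_eq_zero.2 (Or.inl ?_)
  rw [Set.mem_ofPred_eq, homogeneousComponent_zero]
  have h := aeval_translate (0 : Fin 3 → K) f P
  simp only [Pi.zero_apply, zero_add, Algebra.algebraMap_self, RingHom.id_apply] at h
  rw [aeval_zero, Algebra.algebraMap_self, RingHom.id_apply, constantCoeff_eq] at h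
  rw [h]
  simpa [aeval_eq_eval] using hP

end Translation

/-- The slopes of the lines joining a point `P` to a point `x`. -/
def slopes {K : Type u} {F : Type v} [Field K] [Field F] [Algebra K F] (x : Fin 3 → F)
    (P : Fin 3 → K) : Fin 2 → F :=
  ![(x 1 - algebraMap K F (P 1)) / (x 0 - algebraMap K F (P 0)),
    (x 2 - algebraMap K F (P 2)) / (x 0 - algebraMap K F (P 0))]

section Projection

variable {K : Type u} {F : Type v} [Field K] [Field F] [Algebra K F] {x : Fin 3 → F}
  {f : MvPolynomial (Fin 3) K} {P : Fin 3 → K}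

theorem slopes_mul (h0 : x 0 - algebraMap K F (P 0) ≠ 0) :
    ![x 0 - algebraMap K F (P 0), slopes x P 0 * (x 0 - algebraMap K F (P 0)),
      slopes x P 1 * (x 0 - algebraMap K F (P 0))] = fun i => x i - algebraMap K F (P i) := by
  ext i
  fin_cases i
  · rfl
  · exact div_mul_cancel₀ _ h0
  · exact div_mul_cancel₀ _ h0

theorem eval₂_blowUp_translate (hx : aeval x f = 0) (h0 : x 0 - algebraMap K F (P 0) ≠ 0) :
    (blowUp K (translate f P)).eval₂
      (aeval (slopes x P) : MvPolynomial (Fin 2) K →ₐ[K] F).toRingHom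
      (x 0 - algebraMap K F (P 0)) = 0 := by
  rw [eval₂_blowUp, slopes_mul h0, aeval_translate]
  simpa using hx

theorem sub_mult_le_natDegree (hf : f ≠ 0) (hx : ∀ g, aeval x g = 0 → f ∣ g)
    (h0 : x 0 - algebraMap K F (P 0) ≠ 0)
    {q : Polynomial (MvPolynomial (Fin 2) K)} (hq : q ≠ 0)
    (hqa : q.eval₂ (aeval (slopes x P) : MvPolynomial (Fin 2) K →ₐ[K] F).toRingHom
      (x 0 - algebraMap K F (P 0)) = 0) :
    f.totalDegree - mult P f ≤ q.natDegree := by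
  rw [← natTrailingDegree_blowUp_translate hf, ← natDegree_blowUp_translate f P]
  refine natDegree_blowUp_sub_le (slopes x P) _ (fun g hg => ?_) hq hqa
  rw [slopes_mul h0] at hg
  have h1 : aeval x (translate g (-P)) = 0 := by
    rw [aeval_translate]
    simpa [sub_eq_add_neg] using hg
  have h2 := map_dvd (aeval (fun i => X i + C (P i)) : MvPolynomial (Fin 3) K →ₐ[K] _) (hx _ h1)
  have h3 := translate_neg_translate g P
  rw [translate] at h3
  rwa [h3] at h2

/-- If the projection from `P` is not dominant, the surface is a cone with vertex `P`. -/
theorem mult_eq_totalDegree (hf : f ≠ 0) (hx : ∀ g, aeval x g = 0 → f ∣ g)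
    (h0 : x 0 - algebraMap K F (P 0) ≠ 0) (hθ : ¬ AlgebraicIndependent K (slopes x P)) :
    mult P f = f.totalDegree := by
  rw [algebraicIndependent_iff] at hθ
  push Not at hθ
  obtain ⟨r, hr, hr0⟩ := hθ
  -- The relation between the slopes is read as a relation for `a` that is constant in `T`.
  have := sub_mult_le_natDegree hf hx h0 (q := Polynomial.C r) (by simpa using hr0)
    (by rw [Polynomial.eval₂_C]; exact hr)
  rw [Polynomial.natDegree_C] at this
  have := mult_le_totalDegree hf P
  omega

/-- Dependence would force `mult P f = deg f`, but the multiplicity is 0 off the surface and an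
irreducible `f` is not constant. -/
theorem algebraicIndependent_slopes (hf : Irreducible f) (hx : ∀ g, aeval x g = 0 → f ∣ g)
    (h0 : x 0 - algebraMap K F (P 0) ≠ 0) (hP : eval P f ≠ 0) :
    AlgebraicIndependent K (slopes x P) := by
  by_contra h
  have h1 := mult_eq_totalDegree hf.ne_zero hx h0 h
  rw [mult_eq_zero hP] at h1
  have h2 := totalDegree_eq_zero_iff_eq_C.1 h1.symm
  apply hf.not_isUnit
  rw [h2]
  refine IsUnit.map C (isUnit_iff_ne_zero.2 fun h3 => hf.ne_zero ?_)
  rw [h2, h3, map_zero]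

-- Independence makes `K(slopes)` the fraction field of `K[U,V]`, so relations of `a` over it can be
-- compared with polynomials in `T` over `K[U,V]`.
open IntermediateField in
theorem natDegree_minpoly_slopes (hf : f ≠ 0) (hx : ∀ g, aeval x g = 0 ↔ f ∣ g)
    (h0 : x 0 - algebraMap K F (P 0) ≠ 0) (hθ : AlgebraicIndependent K (slopes x P))
    (hint : IsIntegral (adjoin K (Set.range (slopes x P))) (x 0 - algebraMap K F (P 0))) :
    (minpoly (adjoin K (Set.range (slopes x P))) (x 0 - algebraMap K F (P 0))).natDegree =
      f.totalDegree - mult P f := by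
  set M := adjoin K (Set.range (slopes x P)) with hM
  set a := x 0 - algebraMap K F (P 0) with ha
  let ι : MvPolynomial (Fin 2) K →+* M :=
    (hθ.aevalEquivField : FractionRing (MvPolynomial (Fin 2) K) →+* M).comp
      (algebraMap _ (FractionRing (MvPolynomial (Fin 2) K)))
  have hι : (algebraMap M F).comp ι =
      (aeval (slopes x P) : MvPolynomial (Fin 2) K →ₐ[K] F).toRingHom := by
    ext r
    · simp [ι]
    · simp [ι]
  have hιinj : Function.Injective ι :=
    hθ.aevalEquivField.injective.comp (IsFractionRing.injective _ _)
  have heval : ∀ q : Polynomial (MvPolynomial (Fin 2) K),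
      Polynomial.aeval a (q.map ι) =
        q.eval₂ (aeval (slopes x P) : MvPolynomial (Fin 2) K →ₐ[K] F).toRingHom a := by
    intro q
    rw [Polynomial.aeval_def, Polynomial.eval₂_map, hι]
  apply le_antisymm
  -- Upper bound: the full power of `T` is removed from the transformed equation; since `a ≠ 0`, the
  -- quotient still annihilates `a`.
  · obtain ⟨q, hq⟩ := Polynomial.X_pow_dvd_iff.2
      (fun d hd => Polynomial.coeff_eq_zero_of_lt_natTrailingDegree hd :
        ∀ d < (blowUp K (translate f P)).natTrailingDegree, (blowUp K (translate f P)).coeff d = 0)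
    have hb : blowUp K (translate f P) ≠ 0 :=
      (map_ne_zero_iff _ blowUp_injective).2 (translate_ne_zero hf P)
    have hq0 : q ≠ 0 := by
      rintro rfl
      exact hb (by rw [hq, mul_zero])
    have hqa : Polynomial.aeval a (q.map ι) = 0 := by
      have h1 := eval₂_blowUp_translate ((hx f).2 dvd_rfl) h0
      rw [hq, Polynomial.eval₂_mul, Polynomial.eval₂_X_pow, mul_eq_zero] at h1
      rw [heval]
      exact h1.resolve_left (pow_ne_zero _ h0)
    have h2 := Polynomial.natDegree_le_natDegree
      (minpoly.degree_le_of_ne_zero M a ((Polynomial.map_ne_zero_iff hιinj).2 hq0) hqa)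
    refine h2.trans (Polynomial.natDegree_map_le.trans ?_)
    have h3 := congrArg Polynomial.natDegree hq
    rw [natDegree_blowUp_translate, natTrailingDegree_blowUp_translate hf,
      Polynomial.natDegree_mul (pow_ne_zero _ Polynomial.X_ne_zero) hq0,
      Polynomial.natDegree_X_pow] at h3
    omega
  -- Lower bound: clearing denominators in the minimal polynomial gives a relation over `K[U,V]` of
  -- no larger degree.
  · let := ι.toAlgebra
    have : IsFractionRing (MvPolynomial (Fin 2) K) M := by
      refine IsLocalization.isLocalization_of_algEquiv _
        (AlgEquiv.ofRingEquiv
          (f := (hθ.aevalEquivField : FractionRing (MvPolynomial (Fin 2) K) ≃+* M)) ?_)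
      intro r
      rfl
    set p := minpoly M a with hp
    let q := IsLocalization.integerNormalization (nonZeroDivisors (MvPolynomial (Fin 2) K)) p
    have hq0 : q ≠ 0 := by
      intro h
      exact minpoly.ne_zero hint
        ((IsLocalization.integerNormalization_eq_zero_iff le_rfl p).1 h)
    have hqa : q.eval₂ ((algebraMap M F).comp (algebraMap (MvPolynomial (Fin 2) K) M)) a = 0 :=
      IsLocalization.integerNormalization_eval₂_eq_zero _ (algebraMap M F) p (minpoly.aeval M a)
    have hqd : q.natDegree ≤ p.natDegree := by
      rw [Polynomial.natDegree_le_iff_coeff_eq_zero]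
      intro n hn
      by_contra h
      exact Polynomial.mem_support_iff.1 (IsLocalization.integerNormalization_support _ p
        (Polynomial.mem_support_iff.2 h)) (Polynomial.coeff_eq_zero_of_natDegree_lt hn)
    refine (sub_mult_le_natDegree hf (fun g => (hx g).1) h0 hq0 ?_).trans hqd
    rw [← hι]
    exact hqa

open IntermediateField in
theorem adjoin_slopes_adjoin (h0 : x 0 - algebraMap K F (P 0) ≠ 0) :
    (adjoin (adjoin K (Set.range (slopes x P))) {x 0 - algebraMap K F (P 0)}).restrictScalars K =
      adjoin K (Set.range x) := by
  rw [adjoin_adjoin_left]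
  apply le_antisymm
  · rw [adjoin_le_iff]
    have hmem : ∀ i, x i - algebraMap K F (P i) ∈ adjoin K (Set.range x) := fun i =>
      sub_mem (subset_adjoin _ _ ⟨i, rfl⟩) (IntermediateField.algebraMap_mem _ _)
    rintro y (⟨i, rfl⟩ | rfl)
    · fin_cases i
      · exact div_mem (hmem 1) (hmem 0)
      · exact div_mem (hmem 2) (hmem 0)
    · exact hmem 0
  · rw [adjoin_le_iff]
    rintro y ⟨i, rfl⟩
    set E := adjoin K (Set.range (slopes x P) ∪ {x 0 - algebraMap K F (P 0)})
    have ha : x 0 - algebraMap K F (P 0) ∈ E := subset_adjoin _ _ (Or.inr rfl)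
    have hs : ∀ j, slopes x P j ∈ E := fun j => subset_adjoin _ _ (Or.inl ⟨j, rfl⟩)
    have h1 : x i - algebraMap K F (P i) ∈ E := by
      rw [← congrFun (slopes_mul h0) i]
      fin_cases i
      · exact ha
      · exact mul_mem (hs 0) ha
      · exact mul_mem (hs 1) ha
    have := add_mem h1 (E.algebraMap_mem (P i))
    rwa [sub_add_cancel] at this

-- Tower law for `K(slopes) ⊆ K(x) ⊆ F`; the lower step is generated by `a`.
open IntermediateField in
theorem finrank_adjoin_slopes (hf : f ≠ 0) (hx : ∀ g, aeval x g = 0 ↔ f ∣ g)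
    (h0 : x 0 - algebraMap K F (P 0) ≠ 0) (hθ : AlgebraicIndependent K (slopes x P))
    [FiniteDimensional (adjoin K (Set.range (slopes x P))) F] :
    Module.finrank (adjoin K (Set.range (slopes x P))) F =
      (f.totalDegree - mult P f) * Module.finrank (adjoin K (Set.range x)) F := by
  have hint := Algebra.IsIntegral.isIntegral (R := adjoin K (Set.range (slopes x P)))
    (x 0 - algebraMap K F (P 0))
  rw [← natDegree_minpoly_slopes hf hx h0 hθ hint, ← adjoin.finrank hint,
    ← congrArg (fun L : IntermediateField K F => Module.finrank L F) (adjoin_slopes_adjoin h0)]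
  let M := adjoin K (Set.range (slopes x P))
  exact (Module.finrank_mul_finrank M (adjoin M {x 0 - algebraMap K F (P 0)}) F).symm

end Projection

/-! ### Finiteness of the function field over two independent elements. -/

section FunctionField

variable {K : Type u} [Field K]

theorem trdeg_ratFun : Algebra.trdeg K (RatFun K) = 2 := by
  have : Algebra.IsAlgebraic (MvPolynomial (Fin 2) K) (RatFun K) :=
    IsLocalization.isAlgebraic _ (nonZeroDivisors (MvPolynomial (Fin 2) K))
  have h := trdeg_add_eq K (MvPolynomial (Fin 2) K) (A := RatFun K)
  rw [trdeg_eq_zero (R := MvPolynomial (Fin 2) K), add_zero] at h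
  rw [← h]
  simp

-- Two independent elements form a transcendence basis of `K(t,s)`; the algebraic extension is
-- essentially of finite type, hence finite.
open IntermediateField in
theorem finiteDimensional_adjoin {θ : Fin 2 → RatFun K} (hθ : AlgebraicIndependent K θ) :
    FiniteDimensional (adjoin K (Set.range θ)) (RatFun K) := by
  have h1 : IsTranscendenceBasis K θ :=
    hθ.isTranscendenceBasis_of_lift_trdeg_le_of_finite (by rw [trdeg_ratFun]; simp)
  have := h1.isAlgebraic_field
  have : Algebra.EssFiniteType K (RatFun K) := by
    have := Algebra.EssFiniteType.of_isLocalization (RatFun K)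
      (nonZeroDivisors (MvPolynomial (Fin 2) K))
    exact Algebra.EssFiniteType.comp K (MvPolynomial (Fin 2) K) (RatFun K)
  have : Algebra.EssFiniteType (adjoin K (Set.range θ)) (RatFun K) :=
    Algebra.EssFiniteType.of_comp K _ _
  exact Algebra.finite_of_essFiniteType_of_isAlgebraic

end FunctionField

end

/-! ### Numerators of differences `χ(t,s) - χ(h₁,h₂)`. -/

noncomputable section

variable {K : Type u} [Field K]

/-- The inclusion `K[t,s] → K[h₁,h₂][t,s]`. -/
def tsHom (K : Type u) [Field K] : MvPolynomial (Fin 2) K →ₐ[K] PolyTSH K := aeval X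

/-- The inclusion `K[h₁,h₂] → K[h₁,h₂][t,s]`, composed with the renaming of `t, s`. -/
def hHom (K : Type u) [Field K] : MvPolynomial (Fin 2) K →ₐ[K] PolyTSH K :=
  IsScalarTower.toAlgHom K (MvPolynomial (Fin 2) K) (PolyTSH K)

/-- The restriction of polynomials to the diagonal `(t, s) = (h₁, h₂)`. -/
def diagHom (K : Type u) [Field K] : PolyTSH K →ₐ[K] MvPolynomial (Fin 2) K :=
  (aeval X : PolyTSH K →ₐ[MvPolynomial (Fin 2) K] _).restrictScalars K

theorem tsHom_apply (p : MvPolynomial (Fin 2) K) : tsHom K p = map C p := by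
  induction p using MvPolynomial.induction_on with
  | C c =>
    rw [tsHom, aeval_C, map_C]
    rfl
  | add p q hp hq => rw [map_add, map_add, hp, hq]
  | mul_X p i hp =>
    rw [map_mul, map_mul, hp, map_X]
    simp [tsHom]

theorem hHom_apply (p : MvPolynomial (Fin 2) K) : hHom K p = C p := rfl

theorem diagHom_C (p : MvPolynomial (Fin 2) K) : diagHom K (C p) = p :=
  aeval_C (X : Fin 2 → MvPolynomial (Fin 2) K) p

theorem diagHom_hHom (p : MvPolynomial (Fin 2) K) : diagHom K (hHom K p) = p :=
  diagHom_C p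

theorem diagHom_tsHom (p : MvPolynomial (Fin 2) K) : diagHom K (tsHom K p) = p := by
  have : (diagHom K).comp (tsHom K) = AlgHom.id K _ := by
    ext i
    simp [diagHom, tsHom]
  exact DFunLike.congr_fun this p

/-- Substitution of a point for `(h₁, h₂)`. -/
def specialize (a : Fin 2 → K) : PolyTSH K →+* MvPolynomial (Fin 2) K := map (eval a)

theorem specialize_hHom (a : Fin 2 → K) (p : MvPolynomial (Fin 2) K) :
    specialize a (hHom K p) = C (eval a p) := by
  rw [hHom_apply, specialize, map_C]

theorem specialize_tsHom (a : Fin 2 → K) (p : MvPolynomial (Fin 2) K) :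
    specialize a (tsHom K p) = p := by
  rw [tsHom_apply, specialize, map_map]
  convert! map_id p
  ext c
  simp

/-- The numerator of `χ(t,s) - χ(h₁,h₂)` in reduced form. -/
def numerDiff (χ : RatFun K) : PolyTSH K :=
  IsFractionRing.num (PolyTSH K) (inTS K χ - inH K χ)

/-- The numerator of a rational function in reduced form. -/
abbrev numer (χ : RatFun K) : MvPolynomial (Fin 2) K :=
  IsFractionRing.num (MvPolynomial (Fin 2) K) χ

/-- The denominator of a rational function in reduced form. -/
abbrev denom (χ : RatFun K) : MvPolynomial (Fin 2) K :=
  (IsFractionRing.den (MvPolynomial (Fin 2) K) χ : MvPolynomial (Fin 2) K)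

theorem denom_ne_zero (χ : RatFun K) : denom χ ≠ 0 :=
  nonZeroDivisors.coe_ne_zero _

theorem toRat_numer_div_toRat_denom (χ : RatFun K) : toRat (numer χ) / toRat (denom χ) = χ :=
  IsFractionRing.mk'_num_den' _ χ

/-- The polynomial `n(t,s) d(h₁,h₂) - n(h₁,h₂) d(t,s)`, for `χ = n / d`. -/
def crossDiff (χ : RatFun K) : PolyTSH K :=
  tsHom K (numer χ) * hHom K (denom χ) - hHom K (numer χ) * tsHom K (denom χ)

theorem inTS_toRat (p : MvPolynomial (Fin 2) K) :
    inTS K (toRat p) = algebraMap (PolyTSH K) (RatFunTSH K) (tsHom K p) := by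
  rw [tsHom_apply]
  exact IsLocalization.map_eq
    (nonZeroDivisors_le_comap_nonZeroDivisors_of_injective _ (map_injective _ (C_injective (Fin 2) K))) p

theorem inH_toRat (p : MvPolynomial (Fin 2) K) :
    inH K (toRat p) = algebraMap (PolyTSH K) (RatFunTSH K) (hHom K p) := by
  rw [hHom_apply]
  exact IsLocalization.map_eq
    (nonZeroDivisors_le_comap_nonZeroDivisors_of_injective _ (C_injective (Fin 2) (MvPolynomial (Fin 2) K))) p

theorem hHom_ne_zero {p : MvPolynomial (Fin 2) K} (hp : p ≠ 0) : hHom K p ≠ 0 := fun h =>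
  hp (by rw [← diagHom_hHom p, h, map_zero])

theorem tsHom_ne_zero {p : MvPolynomial (Fin 2) K} (hp : p ≠ 0) : tsHom K p ≠ 0 := fun h =>
  hp (by rw [← diagHom_tsHom p, h, map_zero])

/-- Both sides express the same fraction, with `e` its reduced denominator. Thus `numerDiff` can be
replaced by the explicit `crossDiff`, up to factors of the denominators of `χ`. -/
theorem exists_crossDiff_mul_eq (χ : RatFun K) :
    ∃ e : PolyTSH K, IsRelPrime (numerDiff χ) e ∧
      crossDiff χ * e = numerDiff χ * (tsHom K (denom χ) * hHom K (denom χ)) := by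
  refine ⟨_, IsFractionRing.num_den_reduced (PolyTSH K) (inTS K χ - inH K χ), ?_⟩
  apply IsFractionRing.injective (PolyTSH K) (RatFunTSH K)
  have hinj : ∀ {q : PolyTSH K}, q ≠ 0 → algebraMap (PolyTSH K) (RatFunTSH K) q ≠ 0 :=
    (map_ne_zero_iff _ (IsFractionRing.injective (PolyTSH K) (RatFunTSH K))).2
  have h1 := hinj (tsHom_ne_zero (denom_ne_zero χ))
  have h2 := hinj (hHom_ne_zero (denom_ne_zero χ))
  have h3 := hinj (nonZeroDivisors.coe_ne_zero
    (IsFractionRing.den (PolyTSH K) (inTS K χ - inH K χ)))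
  have h4 := IsFractionRing.mk'_num_den' (PolyTSH K) (inTS K χ - inH K χ)
  rw [div_eq_iff h3] at h4
  have hχ : χ * toRat (denom χ) = toRat (numer χ) :=
    (eq_div_iff (toRat_ne_zero (denom_ne_zero χ))).1 (toRat_numer_div_toRat_denom χ).symm
  have h5 : inTS K χ * algebraMap _ _ (tsHom K (denom χ)) = algebraMap _ _ (tsHom K (numer χ)) := by
    rw [← inTS_toRat, ← inTS_toRat, ← map_mul, hχ]
  have h6 : inH K χ * algebraMap _ _ (hHom K (denom χ)) = algebraMap _ _ (hHom K (numer χ)) := by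
    rw [← inH_toRat, ← inH_toRat, ← map_mul, hχ]
  rw [map_mul, map_mul, map_mul, numerDiff, h4, crossDiff, map_sub, map_mul, map_mul, ← h5, ← h6]
  ring

theorem numerDiff_dvd_crossDiff (χ : RatFun K) : numerDiff χ ∣ crossDiff χ := by
  obtain ⟨e, he, h⟩ := exists_crossDiff_mul_eq χ
  exact he.dvd_of_dvd_mul_right ⟨_, h⟩

theorem dvd_numerDiff {χ : RatFun K} {p : PolyTSH K} (hp : Prime p) (h : p ∣ crossDiff χ)
    (h1 : ¬ p ∣ tsHom K (denom χ)) (h2 : ¬ p ∣ hHom K (denom χ)) : p ∣ numerDiff χ := by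
  obtain ⟨e, -, he⟩ := exists_crossDiff_mul_eq χ
  have h3 : p ∣ numerDiff χ * (tsHom K (denom χ) * hHom K (denom χ)) := he ▸ h.mul_right e
  rcases hp.dvd_or_dvd h3 with h4 | h4
  · exact h4
  · rcases hp.dvd_or_dvd h4 with h5 | h5 <;> contradiction

theorem diagHom_numerDiff (χ : RatFun K) : diagHom K (numerDiff χ) = 0 := by
  obtain ⟨e, -, he⟩ := exists_crossDiff_mul_eq χ
  have h := congrArg (diagHom K) he
  have h1 : diagHom K (crossDiff χ) = 0 := by
    simp [crossDiff, diagHom_hHom, diagHom_tsHom, mul_comm]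
  rw [map_mul, h1, zero_mul, map_mul, map_mul, diagHom_hHom, diagHom_tsHom, eq_comm] at h
  exact (mul_eq_zero.1 h).resolve_right (mul_ne_zero (denom_ne_zero χ) (denom_ne_zero χ))

/-- Specializing `(h₁,h₂)` to a point where the denominator is nonzero exhibits `χ` as its value
there. -/
theorem mem_range_of_numerDiff_eq_zero [Infinite K] {χ : RatFun K} (h : numerDiff χ = 0) :
    ∃ c : K, χ = algebraMap K (RatFun K) c := by
  have h0 : crossDiff χ = 0 := zero_dvd_iff.1 (h ▸ numerDiff_dvd_crossDiff χ)
  obtain ⟨a, ha⟩ := exists_eval_ne_zero (denom_ne_zero χ)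
  have h1 := congrArg (specialize a) h0
  rw [crossDiff, map_sub, map_mul, map_mul, specialize_hHom, specialize_hHom, specialize_tsHom,
    specialize_tsHom, map_zero, sub_eq_zero] at h1
  refine ⟨eval a (numer χ) / eval a (denom χ), ?_⟩
  have h2 := congrArg toRat h1
  have hC : ∀ c : K, toRat (C c) = algebraMap K (RatFun K) c := fun c =>
    (IsScalarTower.algebraMap_apply K (MvPolynomial (Fin 2) K) (RatFun K) c).symm
  simp only [toRat, map_mul] at h2
  simp only [← toRat.eq_1, hC] at h2
  conv_lhs => rw [← toRat_numer_div_toRat_denom χ]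
  rw [map_div₀, div_eq_div_iff (toRat_ne_zero (denom_ne_zero χ))
    ((map_ne_zero (algebraMap K (RatFun K))).2 ha)]
  exact h2

/-- A prime element of a `K`-algebra is the kernel of a homomorphism to a field. -/
theorem exists_algHom_eq_zero_iff_dvd {R : Type u} [CommRing R] [Algebra K R] {p : R}
    (hp : Prime p) :
    ∃ (E : Type u) (_ : Field E) (_ : Algebra K E) (π : R →ₐ[K] E), ∀ a, π a = 0 ↔ p ∣ a := by
  have : (Ideal.span {p}).IsPrime := (Ideal.span_singleton_prime hp.ne_zero).2 hp
  refine ⟨FractionRing (R ⧸ Ideal.span {p}), inferInstance, inferInstance,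
    (IsScalarTower.toAlgHom K (R ⧸ Ideal.span {p}) _).comp (Ideal.Quotient.mkₐ K _), fun a => ?_⟩
  rw [AlgHom.comp_apply, IsScalarTower.coe_toAlgHom', ← Ideal.mem_span_singleton,
    ← Ideal.Quotient.eq_zero_iff_mem]
  exact map_eq_zero_iff _ (IsFractionRing.injective _ _)

theorem not_dvd_tsHom_of_isRelPrime [Infinite K] {p : PolyTSH K} (hp : p.totalDegree ≠ 0)
    {n d : MvPolynomial (Fin 2) K} (hnd : IsRelPrime n d) (hn : p ∣ tsHom K n) :
    ¬ p ∣ tsHom K d := by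
  intro hd
  rw [Ne, totalDegree_eq_zero_iff] at hp
  push Not at hp
  obtain ⟨m, hm, i, hi⟩ := hp
  -- At this point the coefficient of a nonconstant monomial of `p` survives, so the specialization
  -- of `p` is a nonconstant common divisor of `n` and `d`.
  obtain ⟨a, ha⟩ := exists_eval_ne_zero (mem_support_iff.1 hm)
  have h1 := map_dvd (specialize a) hn
  have h2 := map_dvd (specialize a) hd
  rw [specialize_tsHom] at h1 h2
  have h3 := (isUnit_iff_totalDegree_of_isReduced.1 (hnd h1 h2)).2
  rw [totalDegree_eq_zero_iff] at h3
  exact hi (h3 m (by rw [mem_support_iff, specialize, coeff_map]; exact ha) i)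

theorem degreeOf_toMvPolynomial_of_ne {R : Type v} {σ : Type w} [CommRing R] [Nontrivial R]
    {i j : σ}
    (hij : i ≠ j) (q : Polynomial R) : degreeOf i (q.toMvPolynomial j) = 0 := by
  classical
  rw [← Nat.le_zero]
  induction q using Polynomial.induction_on' with
  | add p q hp hq =>
    rw [map_add]
    exact (degreeOf_add_le _ _ _).trans (by omega)
  | monomial n a =>
    rw [← Polynomial.C_mul_X_pow_eq_monomial, map_mul, map_pow, Polynomial.toMvPolynomial_C,
      Polynomial.toMvPolynomial_X]
    refine (degreeOf_C_mul_le _ _ _).trans ((degreeOf_pow_le _ _ _).trans ?_)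
    rw [degreeOf_X, if_neg hij, mul_zero]

end

/-! ### Common components of generic fibers and algebraic dependence. -/

noncomputable section

variable {K : Type u} [Field K]

theorem aeval_toRat_numer_div {ι : Type v} (θ : ι → RatFun K) :
    (fun i => (Algebra.ofId (MvPolynomial (Fin 2) K) (RatFun K)).restrictScalars K (numer (θ i)) /
      (Algebra.ofId (MvPolynomial (Fin 2) K) (RatFun K)).restrictScalars K (denom (θ i))) = θ :=
  _root_.funext fun i => toRat_numer_div_toRat_denom (θ i)

/-- Polynomial relations between rational functions persist after substitution, wherever the
denominators do not vanish. -/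
theorem aeval_numer_div_denom_eq_zero {ι : Type v} (θ : ι → RatFun K) {G : MvPolynomial ι K}
    (hG : aeval θ G = 0) {E : Type u} [Field E] [Algebra K E]
    (α : MvPolynomial (Fin 2) K →ₐ[K] E) (hα : ∀ i, α (denom (θ i)) ≠ 0) :
    aeval (fun i => α (numer (θ i)) / α (denom (θ i))) G = 0 := by
  obtain ⟨r, s, h⟩ := exists_fraction_eq_aeval.{u, u, v, u}
    (fun i => numer (θ i)) (fun i => denom (θ i)) G
  obtain ⟨hs, hr⟩ := h (RatFun K)
    ((Algebra.ofId (MvPolynomial (Fin 2) K) (RatFun K)).restrictScalars K)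
    (fun i => toRat_ne_zero (denom_ne_zero _))
  rw [aeval_toRat_numer_div, hG, eq_comm, div_eq_zero_iff] at hr
  have hr0 : r = 0 := by
    by_contra hne
    exact toRat_ne_zero hne (hr.resolve_right hs)
  rw [(h E α hα).2, hr0, map_zero, zero_div]

theorem map_crossDiff_eq_zero_iff {R : Type v} [Field R] [Algebra K R] (π : PolyTSH K →ₐ[K] R)
    {χ : RatFun K} (h1 : π (tsHom K (denom χ)) ≠ 0) (h2 : π (hHom K (denom χ)) ≠ 0) :
    π (crossDiff χ) = 0 ↔ π (tsHom K (numer χ)) / π (tsHom K (denom χ)) =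
      π (hHom K (numer χ)) / π (hHom K (denom χ)) := by
  rw [crossDiff, map_sub, map_mul, map_mul, sub_eq_zero, div_eq_div_iff h1 h2]

section Independent

theorem not_dvd_hHom {p : PolyTSH K} (hp : p.totalDegree ≠ 0) {r : MvPolynomial (Fin 2) K}
    (hr : r ≠ 0) : ¬ p ∣ hHom K r := by
  intro h
  have := totalDegree_le_of_dvd_of_isDomain h (hHom_ne_zero hr)
  rw [hHom_apply, totalDegree_C] at this
  omega

theorem not_algebraicIndependent_three (η : Fin 3 → RatFun K) : ¬ AlgebraicIndependent K η := by
  intro h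
  have := h.lift_cardinalMk_le_trdeg
  rw [trdeg_ratFun] at this
  norm_num at this

/-- If `θ` is algebraically independent, then the generic fiber of `θ` contains no curve. -/
theorem totalDegree_eq_zero_of_dvd_numerDiff [Infinite K] {θ : Fin 2 → RatFun K}
    (hθ : AlgebraicIndependent K θ) {p : PolyTSH K} (hp : Prime p)
    (h : ∀ i, p ∣ numerDiff (θ i)) : p.totalDegree = 0 := by
  by_contra hpos
  have hcross : ∀ i, p ∣ crossDiff (θ i) := fun i => (h i).trans (numerDiff_dvd_crossDiff _)
  have hβ : ∀ {r : MvPolynomial (Fin 2) K}, r ≠ 0 → ¬ p ∣ hHom K r := not_dvd_hHom hpos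
  have hα : ∀ i, ¬ p ∣ tsHom K (denom (θ i)) := by
    intro i hi
    have h1 : p ∣ tsHom K (numer (θ i)) * hHom K (denom (θ i)) := by
      have := (hcross i).add (hi.mul_left (hHom K (numer (θ i))))
      rwa [crossDiff, sub_add_cancel] at this
    have h2 := (hp.dvd_or_dvd h1).resolve_right (hβ (denom_ne_zero _))
    exact not_dvd_tsHom_of_isRelPrime hpos
      (IsFractionRing.num_den_reduced (MvPolynomial (Fin 2) K) (θ i)) h2 hi
  obtain ⟨E, _, _, π, hπ⟩ := exists_algHom_eq_zero_iff_dvd (K := K) hp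
  -- Having positive degree in `t, s`, `p` divides no nonzero polynomial in `h₁, h₂`; hence
  -- `K(h₁,h₂)` embeds in the residue field `E` by `β`.
  have hinj : Function.Injective (π.comp (hHom K)) := by
    rw [injective_iff_map_eq_zero]
    intro r hr
    by_contra hne
    exact hβ hne ((hπ _).1 hr)
  let β : RatFun K →ₐ[K] E := IsFractionRing.liftAlgHom hinj
  have hβr : ∀ r, β (toRat r) = π (hHom K r) := fun r =>
    IsFractionRing.lift_algebraMap (K := RatFun K) hinj r
  have hθβ : ∀ i, π (tsHom K (numer (θ i))) / π (tsHom K (denom (θ i))) = β (θ i) := by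
    intro i
    rw [(map_crossDiff_eq_zero_iff π (fun h0 => hα i ((hπ _).1 h0))
      (fun h0 => hβ (denom_ne_zero _) ((hπ _).1 h0))).1 ((hπ _).2 (hcross i)), ← hβr, ← hβr,
      ← map_div₀, toRat_numer_div_toRat_denom]
  -- The variable `X j` is algebraic over `K(θ)`. Transported to `E`, where `θ(t,s) = θ(h₁,h₂)`,
  -- this makes `X j` algebraic over `K(h₁,h₂)`, so `p` divides a nonzero polynomial in `X j` alone
  -- over `K[h₁,h₂]`.
  have hj : ∀ j k : Fin 2, k ≠ j → degreeOf k p = 0 := by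
    intro j k hkj
    have hdep := not_algebraicIndependent_three ![toRat (X j), θ 0, θ 1]
    rw [algebraicIndependent_iff] at hdep
    push Not at hdep
    obtain ⟨G, hG, hG0⟩ := hdep
    obtain ⟨r, s, hrs⟩ := exists_fraction_eq_aeval.{u, u, 0, u}
      ![X j, numer (θ 0), numer (θ 1)] ![1, denom (θ 0), denom (θ 1)] G
    obtain ⟨hs, hr⟩ := hrs (RatFun K)
      ((Algebra.ofId (MvPolynomial (Fin 2) K) (RatFun K)).restrictScalars K) (by
        intro i
        fin_cases i
        · exact toRat_ne_zero one_ne_zero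
        · exact toRat_ne_zero (denom_ne_zero _)
        · exact toRat_ne_zero (denom_ne_zero _))
    obtain ⟨hs', hr'⟩ := hrs E (π.comp (tsHom K)) (by
        intro i
        fin_cases i
        · simp
        · exact fun h0 => hα 0 ((hπ _).1 h0)
        · exact fun h0 => hα 1 ((hπ _).1 h0))
    have hr0 : r = 0 := by
      by_contra hne
      refine div_ne_zero (toRat_ne_zero hne) hs ?_
      refine hr.symm.trans (Eq.trans ?_ hG)
      refine congrArg (fun y : Fin 3 → _ => aeval y G) (_root_.funext fun i => ?_)
      fin_cases i
      · simp [Algebra.ofId_apply, toRat]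
      · exact toRat_numer_div_toRat_denom (θ 0)
      · exact toRat_numer_div_toRat_denom (θ 1)
    have hE : aeval ![π (X j), β (θ 0), β (θ 1)] G = 0 := by
      rw [hr0, map_zero, zero_div] at hr'
      refine Eq.trans ?_ hr'
      refine congrArg (fun y : Fin 3 → _ => aeval y G) (_root_.funext fun i => ?_)
      fin_cases i
      · simp [tsHom]
      · exact (hθβ 0).symm
      · exact (hθβ 1).symm
    let φ : MvPolynomial (Fin 2) K →+* RatFun K := (aeval θ : MvPolynomial (Fin 2) K →ₐ[K] _)
    have hφ : Function.Injective φ := hθ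
    -- The relation as a polynomial in its first variable; independence of `θ` keeps it nonzero
    -- after the other two variables are replaced by `θ`.
    let Q := (finSuccEquiv K 2 G).map φ
    have hQ0 : Q ≠ 0 := (Polynomial.map_ne_zero_iff hφ).2
      ((map_ne_zero_iff _ (finSuccEquiv K 2).injective).2 hG0)
    have hQE : Q.eval₂ (β : RatFun K →+* E) (π (X j)) = 0 := by
      rw [← hE, Polynomial.eval₂_map]
      have : ∀ g : MvPolynomial (Fin 3) K, (finSuccEquiv K 2 g).eval₂ ((β : RatFun K →+* E).comp φ)
          (π (X j)) = aeval ![π (X j), β (θ 0), β (θ 1)] g := by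
        intro g
        induction g using MvPolynomial.induction_on with
        | C c =>
          rw [← MvPolynomial.algebraMap_eq, AlgEquiv.commutes, Polynomial.algebraMap_apply,
            Polynomial.eval₂_C]
          simp [φ]
        | add p q hp hq => rw [map_add, Polynomial.eval₂_add, hp, hq, map_add]
        | mul_X p i hp =>
          rw [map_mul, Polynomial.eval₂_mul, hp, map_mul]
          congr 1
          refine Fin.cases ?_ (fun i => ?_) i
          · rw [finSuccEquiv_X_zero, Polynomial.eval₂_X]
            simp
          · rw [finSuccEquiv_X_succ, Polynomial.eval₂_C]
            fin_cases i <;> simp [φ]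
      exact this G
    let q := IsLocalization.integerNormalization (nonZeroDivisors (MvPolynomial (Fin 2) K)) Q
    have hq0 : q ≠ 0 := fun h0 =>
      hQ0 ((IsLocalization.integerNormalization_eq_zero_iff le_rfl Q).1 h0)
    have hqE : q.eval₂ ((β : RatFun K →+* E).comp (algebraMap (MvPolynomial (Fin 2) K) (RatFun K)))
        (π (X j)) = 0 :=
      IsLocalization.integerNormalization_eval₂_eq_zero _ (β : RatFun K →+* E) Q hQE
    have hpq : p ∣ q.toMvPolynomial j := by
      rw [← hπ, ← hqE]
      have h1 : ((β : RatFun K →+* E).comp (algebraMap (MvPolynomial (Fin 2) K) (RatFun K))) =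
          (π : PolyTSH K →+* E).comp C := RingHom.ext hβr
      rw [h1]
      exact Polynomial.hom_eval₂ q C (π : PolyTSH K →+* E) (X j)
    obtain ⟨c, hc⟩ := hpq
    have hne : q.toMvPolynomial j ≠ 0 :=
      (map_ne_zero_iff _ (Polynomial.toMvPolynomial_injective j)).2 hq0
    have h1 := degreeOf_toMvPolynomial_of_ne hkj q
    rw [hc] at hne h1
    rw [degreeOf_mul_eq (mul_ne_zero_iff.1 hne).1 (mul_ne_zero_iff.1 hne).2] at h1
    omega
  apply hpos
  rw [totalDegree_eq_zero_iff]
  intro m hm k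
  obtain ⟨j, hkj⟩ : ∃ j, k ≠ j := ⟨k + 1, by fin_cases k <;> decide⟩
  have := monomial_le_degreeOf k hm
  have := hj j k hkj
  omega

end Independent

section Dependent

/-- Divided differences in the first variable. -/
theorem exists_dividedDifference (G : MvPolynomial (Fin 2) K) :
    ∃ S : MvPolynomial (Fin 3) K, ∀ (E : Type v) [Field E] [Algebra K E] (a b c : E),
      aeval ![a, c] G - aeval ![b, c] G = (a - b) * aeval ![a, b, c] S ∧
      aeval ![a, a, c] S = aeval ![a, c] (pderiv 0 G) := by
  induction G using MvPolynomial.induction_on with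
  | C c => exact ⟨0, fun E _ _ a b d => by simp⟩
  | add p q hp hq =>
    obtain ⟨S, hS⟩ := hp
    obtain ⟨T, hT⟩ := hq
    refine ⟨S + T, fun E _ _ a b c => ?_⟩
    obtain ⟨h1, h2⟩ := hS E a b c
    obtain ⟨h3, h4⟩ := hT E a b c
    refine ⟨?_, by simp only [map_add, h2, h4]⟩
    simp only [map_add]
    linear_combination h1 + h3
  | mul_X p i hp =>
    obtain ⟨S, hS⟩ := hp
    fin_cases i
    -- From `a p(a,c) - b p(b,c) = (a - b) p(a,c) + b (p(a,c) - p(b,c))`.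
    · refine ⟨rename ![0, 2] p + X 1 * S, fun E _ _ a b c => ?_⟩
      obtain ⟨h1, h2⟩ := hS E a b c
      have hren : ∀ b' : E, aeval ![a, b', c] (rename ![0, 2] p) = aeval ![a, c] p := by
        intro b'
        rw [aeval_rename]
        congr 2
        ext i
        fin_cases i <;> rfl
      constructor
      · simp [hren]
        linear_combination b * h1
      · simp [hren, h2]
    · refine ⟨S * X 2, fun E _ _ a b c => ?_⟩
      obtain ⟨h1, h2⟩ := hS E a b c
      constructor
      · simp
        linear_combination c * h1
      · simp [h2, mul_comm]

theorem finSuccEquiv_pderiv_zero {n : ℕ} (G : MvPolynomial (Fin (n + 1)) K) :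
    finSuccEquiv K n (pderiv 0 G) = Polynomial.derivative (finSuccEquiv K n G) := by
  induction G using MvPolynomial.induction_on with
  | C c =>
    rw [pderiv_C, map_zero, ← MvPolynomial.algebraMap_eq, AlgEquiv.commutes,
      Polynomial.algebraMap_apply, Polynomial.derivative_C]
  | add p q hp hq => rw [map_add, map_add, map_add, hp, hq, Polynomial.derivative_add]
  | mul_X p i hp =>
    have h : finSuccEquiv K n (pderiv 0 (X i)) =
        Polynomial.derivative (finSuccEquiv K n (X i)) := by
      refine Fin.cases ?_ (fun i => ?_) i
      · rw [pderiv_X_self, finSuccEquiv_X_zero, map_one, Polynomial.derivative_X]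
      · rw [pderiv_X_of_ne (Fin.succ_ne_zero i), finSuccEquiv_X_succ, map_zero,
          Polynomial.derivative_C]
    rw [pderiv_mul, map_add, map_mul, map_mul, map_mul, hp, h, Polynomial.derivative_mul]

theorem finSuccEquiv_rename_succ {n : ℕ} (r : MvPolynomial (Fin n) K) :
    finSuccEquiv K n (rename Fin.succ r) = Polynomial.C r := by
  induction r using MvPolynomial.induction_on with
  | C c =>
    rw [rename_C, ← MvPolynomial.algebraMap_eq, AlgEquiv.commutes, Polynomial.algebraMap_apply]
    rfl
  | add p q hp hq => rw [map_add, map_add, hp, hq, Polynomial.C_add]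
  | mul_X p i hp => rw [map_mul, map_mul, hp, rename_X, finSuccEquiv_X_succ, Polynomial.C_mul]

/-- A separable relation for a dependent pair. -/
theorem exists_aeval_pderiv_ne_zero [CharZero K] {F : Type v} [Field F] [Algebra K F] {a b : F}
    (hb : Transcendental K b) (hab : ¬ AlgebraicIndependent K ![a, b]) :
    ∃ G : MvPolynomial (Fin 2) K, aeval ![a, b] G = 0 ∧ aeval ![a, b] (pderiv 0 G) ≠ 0 := by
  classical
  rw [algebraicIndependent_iff] at hab
  push Not at hab
  -- A nonzero relation of least degree in the first variable is separable: its derivative has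
  -- smaller degree and, in characteristic zero, is nonzero unless that degree is 0, which
  -- transcendence of `b` excludes.
  have hex : ∃ n, ∃ G : MvPolynomial (Fin 2) K, aeval ![a, b] G = 0 ∧ G ≠ 0 ∧
      (finSuccEquiv K 1 G).natDegree = n := by
    obtain ⟨G, h1, h2⟩ := hab
    exact ⟨_, G, h1, h2, rfl⟩
  obtain ⟨G, hG, hG0, hdeg⟩ := Nat.find_spec hex
  refine ⟨G, hG, fun hG' => ?_⟩
  rcases Nat.eq_zero_or_pos (finSuccEquiv K 1 G).natDegree with h0 | hpos
  · obtain ⟨r, hr⟩ := Polynomial.natDegree_eq_zero.1 h0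
    have hGr : G = rename Fin.succ r := by
      apply (finSuccEquiv K 1).injective
      rw [← hr, finSuccEquiv_rename_succ]
    have hb' : AlgebraicIndependent K ![b] := algebraicIndependent_unique_type_iff.2 hb
    rw [hGr, aeval_rename] at hG
    have hr0 : r = 0 := by
      rw [algebraicIndependent_iff] at hb'
      refine hb' r ?_
      rw [← hG]
      congr 2
    exact hG0 (by rw [hGr, hr0, map_zero])
  · refine Nat.find_min hex (m := (finSuccEquiv K 1 (pderiv 0 G)).natDegree) ?_
      ⟨pderiv 0 G, hG', fun h0 => ?_, rfl⟩
    · rw [← hdeg, finSuccEquiv_pderiv_zero]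
      exact Polynomial.natDegree_derivative_lt hpos.ne'
    · have h1 := finSuccEquiv_pderiv_zero G
      rw [h0, map_zero] at h1
      exact hpos.ne' (Polynomial.derivative_eq_zero.1 h1.symm)

/-- If `χ` depends algebraically on `ψ`, then a component of the fiber of `ψ` over the generic
value which passes through the generic point lies in the fiber of `χ`. -/
theorem dvd_numerDiff_of_not_algebraicIndependent [CharZero K] {χ ψ : RatFun K}
    (hψ : Transcendental K ψ) (hχψ : ¬ AlgebraicIndependent K ![χ, ψ]) {p : PolyTSH K}
    (hp : Prime p) (hdiag : diagHom K p = 0) (hpψ : p ∣ numerDiff ψ) : p ∣ numerDiff χ := by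
  obtain ⟨G, hG, hG'⟩ := exists_aeval_pderiv_ne_zero hψ hχψ
  obtain ⟨S, hS⟩ := exists_dividedDifference.{u, u} G
  obtain ⟨E, _, _, π, hπ⟩ := exists_algHom_eq_zero_iff_dvd (K := K) hp
  have hnd : ∀ a, diagHom K a ≠ 0 → π a ≠ 0 := by
    intro a ha h0
    obtain ⟨c, rfl⟩ := (hπ a).1 h0
    exact ha (by rw [map_mul, hdiag, zero_mul])
  have hts : ∀ {d}, d ≠ 0 → π (tsHom K d) ≠ 0 := fun hd => hnd _ (by rwa [diagHom_tsHom])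
  have hh : ∀ {d}, d ≠ 0 → π (hHom K d) ≠ 0 := fun hd => hnd _ (by rwa [diagHom_hHom])
  have hψE := (map_crossDiff_eq_zero_iff π (hts (denom_ne_zero ψ)) (hh (denom_ne_zero ψ))).1
    ((hπ _).2 (hpψ.trans (numerDiff_dvd_crossDiff ψ)))
  refine dvd_numerDiff hp ((hπ _).1 ?_) (fun h0 => hts (denom_ne_zero χ) ((hπ _).2 h0))
    (fun h0 => hh (denom_ne_zero χ) ((hπ _).2 h0))
  rw [map_crossDiff_eq_zero_iff π (hts (denom_ne_zero χ)) (hh (denom_ne_zero χ))]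
  have hrel : ∀ α : MvPolynomial (Fin 2) K →ₐ[K] E, (∀ {d}, d ≠ 0 → α d ≠ 0) →
      aeval ![α (numer χ) / α (denom χ), α (numer ψ) / α (denom ψ)] G = 0 := by
    intro α hα
    rw [← aeval_numer_div_denom_eq_zero ![χ, ψ] hG α (fun i => hα (denom_ne_zero _))]
    refine congrArg (fun y : Fin 2 → E => aeval y G) (_root_.funext fun i => ?_)
    fin_cases i <;> rfl
  have h1 := hrel (π.comp (tsHom K)) hts
  have h2 := hrel (π.comp (hHom K)) hh
  simp only [AlgHom.comp_apply] at h1 h2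
  rw [hψE] at h1
  have h3 := (hS E (π (tsHom K (numer χ)) / π (tsHom K (denom χ)))
    (π (hHom K (numer χ)) / π (hHom K (denom χ)))
    (π (hHom K (numer ψ)) / π (hHom K (denom ψ)))).1
  rw [h1, h2, sub_zero, eq_comm, mul_eq_zero] at h3
  -- In `E` the two values of `ψ` agree, so the difference of the values of `χ` times `S` is zero;
  -- it remains to see that `S` does not vanish modulo `p`.
  refine sub_eq_zero.1 (h3.resolve_right ?_)
  obtain ⟨r, s, hrs⟩ := exists_fraction_eq_aeval.{u, u, 0, u}
    ![tsHom K (numer χ), hHom K (numer χ), hHom K (numer ψ)]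
    ![tsHom K (denom χ), hHom K (denom χ), hHom K (denom ψ)] S
  obtain ⟨hs, hr⟩ := hrs (RatFun K)
    (((Algebra.ofId (MvPolynomial (Fin 2) K) (RatFun K)).restrictScalars K).comp (diagHom K)) (by
      intro i
      fin_cases i <;> simp only [AlgHom.comp_apply]
      · refine toRat_ne_zero (Eq.trans_ne (diagHom_tsHom _) (denom_ne_zero χ))
      · refine toRat_ne_zero (Eq.trans_ne (diagHom_hHom _) (denom_ne_zero χ))
      · refine toRat_ne_zero (Eq.trans_ne (diagHom_hHom _) (denom_ne_zero ψ)))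
  obtain ⟨hs', hr'⟩ := hrs E π (by
      intro i
      fin_cases i
      · exact hts (denom_ne_zero χ)
      · exact hh (denom_ne_zero χ)
      · exact hh (denom_ne_zero ψ))
  -- On the diagonal `S` becomes the partial derivative of `G` at `(χ, ψ)`, which is nonzero,
  -- whereas every multiple of `p` vanishes there.
  have hr0 : diagHom K r ≠ 0 := by
    intro h0
    apply hG'
    rw [← (hS (RatFun K) χ χ ψ).2]
    rw [AlgHom.comp_apply, h0, map_zero, zero_div] at hr
    rw [← hr]
    refine congrArg (fun y : Fin 3 → _ => aeval y S) (_root_.funext fun i => ?_)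
    fin_cases i
    · refine (toRat_numer_div_toRat_denom χ).symm.trans ?_
      simp [diagHom_tsHom, toRat_numer_div_toRat_denom]
    · refine (toRat_numer_div_toRat_denom χ).symm.trans ?_
      simp [diagHom_hHom, toRat_numer_div_toRat_denom]
    · refine (toRat_numer_div_toRat_denom ψ).symm.trans ?_
      simp [diagHom_hHom, toRat_numer_div_toRat_denom]
  have h4 : aeval ![π (tsHom K (numer χ)) / π (tsHom K (denom χ)),
      π (hHom K (numer χ)) / π (hHom K (denom χ)),
      π (hHom K (numer ψ)) / π (hHom K (denom ψ))] S = π r / π s := by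
    rw [← hr']
    refine congrArg (fun y : Fin 3 → _ => aeval y S) (_root_.funext fun i => ?_)
    fin_cases i <;> rfl
  rw [h4]
  exact div_ne_zero (hnd r hr0) hs'

end Dependent

end

/-! ### The gcd criterion and the passage to slopes. -/

noncomputable section

variable {K : Type u} [Field K]

theorem mem_range_of_not_transcendental [IsAlgClosed K] {F : Type v} [Field F] [Algebra K F]
    {a : F} (ha : ¬ Transcendental K a) : ∃ c : K, a = algebraMap K F c := by
  have hint : IsIntegral K a := (not_not.1 ha : IsAlgebraic K a).isIntegral
  obtain ⟨c, hc⟩ := minpoly.mem_range_of_degree_eq_one K a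
    (IsAlgClosed.degree_eq_one_of_irreducible K (minpoly.irreducible hint))
  exact ⟨c, hc.symm⟩

theorem totalDegree_ne_zero_of_diagHom {p : PolyTSH K} (hp : p ≠ 0) (hd : diagHom K p = 0) :
    p.totalDegree ≠ 0 := by
  intro h
  rw [totalDegree_eq_zero_iff_eq_C] at h
  rw [h, diagHom_C] at hd
  exact hp (by rw [h, hd, map_zero])

/-- A common divisor vanishing on the diagonal for a pair of dependent rational functions. -/
theorem exists_common_divisor [IsAlgClosed K] [CharZero K] {χ ψ : RatFun K}
    (hχψ : ¬ AlgebraicIndependent K ![χ, ψ])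
    (hc : ¬ ((∃ c : K, χ = algebraMap K _ c) ∧ ∃ c : K, ψ = algebraMap K _ c)) :
    (numerDiff χ ≠ 0 ∨ numerDiff ψ ≠ 0) ∧
      ∃ p : PolyTSH K, p.totalDegree ≠ 0 ∧ p ∣ numerDiff χ ∧ p ∣ numerDiff ψ := by
  by_cases hψ : numerDiff ψ = 0
  · have hχ : numerDiff χ ≠ 0 := fun hχ =>
      hc ⟨mem_range_of_numerDiff_eq_zero hχ, mem_range_of_numerDiff_eq_zero hψ⟩
    exact ⟨Or.inl hχ, numerDiff χ, totalDegree_ne_zero_of_diagHom hχ (diagHom_numerDiff χ),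
      dvd_rfl, hψ ▸ dvd_zero _⟩
  · refine ⟨Or.inr hψ, ?_⟩
    obtain ⟨s, hs, hprod⟩ := UniqueFactorizationMonoid.exists_prime_factors _ hψ
    have hker := RingHom.ker_isPrime (diagHom K)
    have hmem : s.prod ∈ RingHom.ker (diagHom K) := by
      obtain ⟨c, hc⟩ := hprod.symm
      rw [← hc, RingHom.mem_ker, map_mul, diagHom_numerDiff, zero_mul]
    -- The numerator vanishes on the diagonal, whose ideal is prime, so one of its prime factors
    -- does too.
    obtain ⟨p, hps, hp⟩ := (hker.multiset_prod_mem_iff_exists_mem s).1 hmem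
    have hpψ : p ∣ numerDiff ψ := (Multiset.dvd_prod hps).trans hprod.dvd
    refine ⟨p, totalDegree_ne_zero_of_diagHom (hs p hps).ne_zero hp, ?_, hpψ⟩
    refine dvd_numerDiff_of_not_algebraicIndependent ?_ hχψ (hs p hps) hp hpψ
    by_contra hψt
    obtain ⟨c, rfl⟩ := mem_range_of_not_transcendental hψt
    apply hψ
    have : inTS K (algebraMap K (RatFun K) c) = inH K (algebraMap K (RatFun K) c) := by
      rw [IsScalarTower.algebraMap_apply K (MvPolynomial (Fin 2) K) (RatFun K)]
      refine (inTS_toRat _).trans (Eq.trans ?_ (inH_toRat _).symm)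
      rw [tsHom_apply, hHom_apply, MvPolynomial.algebraMap_eq, map_C]
    rw [numerDiff, this, sub_self, IsFractionRing.num_zero]

theorem gGcd_dvd (N D : Fin 3 → MvPolynomial (Fin 2) K) (P : Fin 3 → K) (i : Fin 2) :
    gGcd N D P ∣ numerDiff (Phi23 N D P i) := by
  let := UniqueFactorizationMonoid.toGCDMonoid (PolyTSH K)
  fin_cases i
  · exact gcd_dvd_left _ _
  · exact gcd_dvd_right _ _

theorem dvd_gGcd {N D : Fin 3 → MvPolynomial (Fin 2) K} {P : Fin 3 → K} {p : PolyTSH K}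
    (h : ∀ i, p ∣ numerDiff (Phi23 N D P i)) : p ∣ gGcd N D P := by
  let := UniqueFactorizationMonoid.toGCDMonoid (PolyTSH K)
  exact dvd_gcd (h 0) (h 1)

theorem gPoly_eq_one_iff (N D : Fin 3 → MvPolynomial (Fin 2) K) (P : Fin 3 → K) :
    gPoly N D P = 1 ↔ (gGcd N D P).totalDegree = 0 := by
  rw [gPoly]
  split_ifs with h
  · refine ⟨fun h1 => ?_, fun h1 => absurd h1 h.ne'⟩
    rw [h1, totalDegree_one]
  · exact ⟨fun _ => by omega, fun _ => rfl⟩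

theorem totalDegree_gGcd_eq_zero [Infinite K] {N D : Fin 3 → MvPolynomial (Fin 2) K}
    {P : Fin 3 → K} (hθ : AlgebraicIndependent K (Phi23 N D P)) :
    (gGcd N D P).totalDegree = 0 := by
  rcases eq_or_ne (gGcd N D P) 0 with h0 | h0
  · rw [h0, totalDegree_zero]
  obtain ⟨s, hs, hprod⟩ := UniqueFactorizationMonoid.exists_prime_factors _ h0
  have hdeg : ∀ p ∈ s, p.totalDegree = 0 := fun p hp =>
    totalDegree_eq_zero_of_dvd_numerDiff hθ (hs p hp) fun i =>
      ((Multiset.dvd_prod hp).trans hprod.dvd).trans (gGcd_dvd N D P i)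
  have hs0 : s.prod ≠ 0 := fun h => h0 (hprod.eq_zero_iff.1 h)
  have h1 := totalDegree_le_of_dvd_of_isDomain hprod.symm.dvd hs0
  have h2 := totalDegree_multiset_prod s
  rw [Multiset.sum_eq_zero (by simpa using hdeg)] at h2
  omega

theorem totalDegree_gGcd_ne_zero [IsAlgClosed K] [CharZero K]
    {N D : Fin 3 → MvPolynomial (Fin 2) K} {P : Fin 3 → K}
    (hθ : ¬ AlgebraicIndependent K (Phi23 N D P))
    (hc : ¬ ∀ i, ∃ c : K, Phi23 N D P i = algebraMap K _ c) :
    (gGcd N D P).totalDegree ≠ 0 := by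
  have h2 : Phi23 N D P = ![Phi23 N D P 0, Phi23 N D P 1] := by
    ext i
    fin_cases i <;> rfl
  rw [h2] at hθ
  obtain ⟨hne, p, hp, h0, h1⟩ := exists_common_divisor hθ fun h => hc (by
    intro i
    fin_cases i
    · exact h.1
    · exact h.2)
  -- The zero polynomial has `totalDegree` 0, so a zero gcd has to be excluded before degrees are
  -- compared.
  have hg0 : gGcd N D P ≠ 0 := by
    intro hg
    rcases hne with h | h
    · exact h (zero_dvd_iff.1 (hg ▸ gGcd_dvd N D P 0))
    · exact h (zero_dvd_iff.1 (hg ▸ gGcd_dvd N D P 1))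
  have h3 := totalDegree_le_of_dvd_of_isDomain (dvd_gGcd (N := N) (D := D) (P := P) (p := p) (by
    intro i
    fin_cases i
    · exact h0
    · exact h1)) hg0
  omega

theorem totalDegree_ne_zero_of_irreducible {f : MvPolynomial (Fin 3) K} (hf : Irreducible f) :
    f.totalDegree ≠ 0 := by
  intro h
  exact hf.not_isUnit (isUnit_iff_totalDegree_of_isReduced.2 ⟨by
    rw [isUnit_iff_ne_zero]
    intro h0
    rw [totalDegree_eq_zero_iff_eq_C.1 h, h0, map_zero] at hf
    exact hf.ne_zero rfl, h⟩)

/-- A polynomial of degree at most one divisible by an irreducible `f` is a multiple of `f`. -/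
theorem exists_eq_mul_C {f g : MvPolynomial (Fin 3) K} (hf : Irreducible f) (hg : g ≠ 0)
    (hg1 : g.totalDegree ≤ 1) (h : f ∣ g) : ∃ c : K, c ≠ 0 ∧ g = f * C c := by
  obtain ⟨e, rfl⟩ := h
  have he := right_ne_zero_of_mul hg
  rw [totalDegree_mul_of_isDomain hf.ne_zero he] at hg1
  have hf1 := totalDegree_ne_zero_of_irreducible hf
  have h1 := totalDegree_eq_zero_iff_eq_C.1 (show e.totalDegree = 0 by omega)
  refine ⟨e.coeff 0, fun h0 => he (by rw [h1, h0, map_zero]), by rw [← h1]⟩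

/-- Constant slopes would put the generic point on a line through `P`, giving two linear relations.
Both would be nonzero scalar multiples of `f`, though they are not proportional. -/
theorem slopes_not_constant {F : Type v} [Field F] [Algebra K F] {x : Fin 3 → F}
    {f : MvPolynomial (Fin 3) K} {P : Fin 3 → K} (hf : Irreducible f)
    (hx : ∀ g, aeval x g = 0 → f ∣ g) (h0 : x 0 - algebraMap K F (P 0) ≠ 0) :
    ¬ ∀ i, ∃ c : K, slopes x P i = algebraMap K F c := by
  intro h
  choose c hc using h
  have key : ∀ i : Fin 2, f ∣ (X i.succ - C (P i.succ)) - C (c i) * (X 0 - C (P 0)) := by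
    intro i
    apply hx
    have h1 := congrFun (slopes_mul h0) i.succ
    have h2 : slopes x P i * (x 0 - algebraMap K F (P 0)) =
        x i.succ - algebraMap K F (P i.succ) := by
      rw [← h1]
      fin_cases i <;> rfl
    rw [hc] at h2
    simp only [map_sub, map_mul, aeval_X, aeval_C]
    rw [h2, sub_self]
  -- Values at the unit steps from `P` separate the two linear forms.
  have hval : ∀ i j : Fin 2, eval (P + Pi.single j.succ 1)
      ((X i.succ - C (P i.succ)) - C (c i) * (X 0 - C (P 0)) : MvPolynomial (Fin 3) K) =
        if i = j then 1 else 0 := by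
    intro i j
    fin_cases i <;> fin_cases j <;> simp
  have hdeg : ∀ i : Fin 2, ((X i.succ - C (P i.succ)) - C (c i) * (X 0 - C (P 0)) :
      MvPolynomial (Fin 3) K).totalDegree ≤ 1 := by
    intro i
    have hlin : ∀ (j : Fin 3) (a : K), (X j - C a : MvPolynomial (Fin 3) K).totalDegree ≤ 1 :=
      fun j a => (totalDegree_sub _ _).trans (by simp)
    refine (totalDegree_sub _ _).trans (max_le (hlin _ _) ((totalDegree_mul _ _).trans ?_))
    rw [totalDegree_C, zero_add]
    exact hlin _ _
  have hne : ∀ i : Fin 2,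
      ((X i.succ - C (P i.succ)) - C (c i) * (X 0 - C (P 0)) : MvPolynomial (Fin 3) K) ≠ 0 := by
    intro i hi
    have := hval i i
    rw [hi] at this
    simp at this
  obtain ⟨a, ha, ha'⟩ := exists_eq_mul_C hf (hne 0) (hdeg 0) (key 0)
  obtain ⟨b, hb, hb'⟩ := exists_eq_mul_C hf (hne 1) (hdeg 1) (key 1)
  have h1 := hval 0 0
  have h2 := hval 1 0
  rw [ha', map_mul, eval_C] at h1
  rw [hb', map_mul, eval_C] at h2
  simp only [if_true] at h1
  rw [if_neg (by decide), mul_eq_zero] at h2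
  rw [h2.resolve_right hb, zero_mul] at h1
  exact zero_ne_one h1

theorem Phi23_eq_slopes {N D : Fin 3 → MvPolynomial (Fin 2) K} (hD : ∀ i, D i ≠ 0)
    (P : Fin 3 → K) : Phi23 N D P = slopes (paramMap N D) P := by
  have hd : ∀ i, toRat (D i) ≠ 0 := fun i => toRat_ne_zero (hD i)
  have hC : ∀ c : K, toRat (C c) = algebraMap K (RatFun K) c := fun c =>
    (IsScalarTower.algebraMap_apply K (MvPolynomial (Fin 2) K) (RatFun K) c).symm
  have hsub : ∀ i, toRat (N i - C (P i) * D i) =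
      (paramMap N D i - algebraMap K _ (P i)) * toRat (D i) := by
    intro i
    rw [sub_mul, paramMap, div_mul_cancel₀ _ (hd i), ← hC]
    simp [toRat]
  have key : ∀ i : Fin 3, toRat (N i - C (P i) * D i) / toRat (N 0 - C (P 0) * D 0) *
      (toRat (D 0) / toRat (D i)) = (paramMap N D i - algebraMap K _ (P i)) /
        (paramMap N D 0 - algebraMap K _ (P 0)) := by
    intro i
    rw [hsub, hsub, div_mul_div_comm, mul_assoc, mul_assoc, mul_comm (toRat (D 0)),
      mul_div_mul_right _ _ (mul_ne_zero (hd i) (hd 0))]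
  ext i
  fin_cases i
  · exact key 1
  · exact key 2

/-- The first coordinate is constant on the surface only if the surface is a coordinate plane. -/
theorem paramMap_sub_ne_zero [IsAlgClosed K]
    {Z : Set (Fin 3 → K)} {f : MvPolynomial (Fin 3) K} (hf : IsDefiningPolynomial f Z)
    {N D : Fin 3 → MvPolynomial (Fin 2) K} (hQ : IsRationalParametrization N D Z) {i : Fin 3}
    {c : K} (hZ : Z ≠ {P | P i = c}) : paramMap N D i - algebraMap K _ c ≠ 0 := by
  intro h
  apply hZ
  have hdvd : f ∣ X i - C c := by
    rw [← aeval_paramMap_eq_zero_iff_dvd hf hQ]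
    simpa using h
  have hne : (X i - C c : MvPolynomial (Fin 3) K) ≠ 0 := by
    intro h0
    have := congrArg (eval fun _ => c + 1) h0
    simp at this
  obtain ⟨a, ha, hfa⟩ := exists_eq_mul_C hf.1 hne ((totalDegree_sub _ _).trans (by simp)) hdvd
  rw [hf.2]
  ext P
  have hP := congrArg (eval P) hfa
  rw [map_sub, eval_X, eval_C, map_mul, eval_C] at hP
  rw [Set.mem_ofPred_eq, Set.mem_ofPred_eq, ← sub_eq_zero (a := P i), hP]
  simp [ha]

end

end RationalSurface

theorem mainTheorem2 {K : Type*} [Field K] [IsAlgClosed K] [CharZero K]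
    (Z : Set (Fin 3 → K)) (f : MvPolynomial (Fin 3) K)
    (hf : RationalSurface.IsDefiningPolynomial f Z)
    (N D : Fin 3 → MvPolynomial (Fin 2) K)
    (hQ : RationalSurface.IsRationalParametrization N D Z)
    (hplane : ∀ (i : Fin 3) (c : K), Z ≠ {P | P i = c})
    (A₀ A : Fin 3 → K) (hA₀ : A₀ ∉ Z)
    (hN : ∀ i, RationalSurface.AvoidsInfty (N i))
    (hD : ∀ i, RationalSurface.AvoidsInfty (D i))
    (hNA : ∀ i, RationalSurface.AvoidsInfty (N i - MvPolynomial.C (A i) * D i))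
    (hNA₀ : ∀ i, RationalSurface.AvoidsInfty (N i - MvPolynomial.C (A₀ i) * D i)) :
    0 < RationalSurface.mapDegree (RationalSurface.paramMap N D) ∧
    0 < RationalSurface.mapDegree (RationalSurface.Phi23 N D A₀) ∧
    (RationalSurface.gPoly N D A = 1 →
      0 < RationalSurface.mapDegree (RationalSurface.Phi23 N D A) ∧
      (RationalSurface.mult A f : ℚ) =
        ((RationalSurface.mapDegree (RationalSurface.Phi23 N D A₀) : ℚ) -
          (RationalSurface.mapDegree (RationalSurface.Phi23 N D A) : ℚ)) /
          (RationalSurface.mapDegree (RationalSurface.paramMap N D) : ℚ)) ∧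
    (RationalSurface.gPoly N D A ≠ 1 →
      (RationalSurface.mult A f : ℚ) =
        (RationalSurface.mapDegree (RationalSurface.Phi23 N D A₀) : ℚ) /
          (RationalSurface.mapDegree (RationalSurface.paramMap N D) : ℚ)) := by
  open RationalSurface in
  have hx := aeval_paramMap_eq_zero_iff_dvd hf hQ
  have hx' := fun g => (hx g).1
  have hf0 := hf.1.ne_zero
  have hw : ∀ P : Fin 3 → K, paramMap N D 0 - algebraMap K _ (P 0) ≠ 0 := fun P =>
    paramMap_sub_ne_zero hf hQ (hplane 0 (P 0))
  have hΦ := Phi23_eq_slopes (N := N) hQ.den_ne_zero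
  have hpos : ∀ P, AlgebraicIndependent K (Phi23 N D P) → 0 < mapDegree (Phi23 N D P) := by
    intro P hP
    have := finiteDimensional_adjoin hP
    exact Module.finrank_pos
  have hdeg : ∀ P, AlgebraicIndependent K (Phi23 N D P) → mapDegree (Phi23 N D P) =
      (f.totalDegree - mult P f) * mapDegree (paramMap N D) := by
    intro P hP
    have := finiteDimensional_adjoin hP
    rw [hΦ] at hP this ⊢
    exact finrank_adjoin_slopes hf0 hx (hw P) hP
  have hA₀f : MvPolynomial.eval A₀ f ≠ 0 := fun h => hA₀ (by rw [hf.2]; exact h)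
  have hind₀ : AlgebraicIndependent K (Phi23 N D A₀) := by
    rw [hΦ]
    exact algebraicIndependent_slopes hf.1 hx' (hw A₀) hA₀f
  have hpos₀ := hpos A₀ hind₀
  have hdeg₀ := hdeg A₀ hind₀
  rw [mult_eq_zero hA₀f, Nat.sub_zero] at hdeg₀
  -- `mapDegree` is 0 for infinite extensions; the positive product `d · deg Q` rules this out for
  -- the parametrization.
  have hposQ : 0 < mapDegree (paramMap N D) := by
    rw [hdeg₀] at hpos₀
    exact Nat.pos_of_mul_pos_left hpos₀
  have hposQ' : (mapDegree (paramMap N D) : ℚ) ≠ 0 := by exact_mod_cast hposQ.ne'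
  refine ⟨hposQ, hpos₀, fun hg => ?_, fun hg => ?_⟩
  · have hind : AlgebraicIndependent K (Phi23 N D A) := by
      by_contra hdep
      refine totalDegree_gGcd_ne_zero hdep ?_ ((gPoly_eq_one_iff N D A).1 hg)
      rw [hΦ]
      exact slopes_not_constant hf.1 hx' (hw A)
    refine ⟨hpos A hind, ?_⟩
    rw [hdeg A hind, hdeg₀, eq_div_iff hposQ']
    push_cast [Nat.cast_sub (mult_le_totalDegree hf0 A)]
    ring
  · have hdep : ¬ AlgebraicIndependent K (Phi23 N D A) := fun hind =>
      hg ((gPoly_eq_one_iff N D A).2 (totalDegree_gGcd_eq_zero hind))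
    rw [hΦ] at hdep
    rw [mult_eq_totalDegree hf0 hx' (hw A) hdep, hdeg₀, eq_div_iff hposQ']
    push_cast
    rfl
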